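/- Let $P$ be a finite partially ordered set. The order polytope $\mathcal{O}(P)\subset\mathbb{R}^P$ is the set of all $x$ with $0\le x_p\le 1$ for all $p\in P$ and $x_p\ge x_q$ whenever $p\le q$ in $P$; the chain polytope $\mathcal{C}(P)\subset\mathbb{R}^P$ is the set of all $x$ with $x_p\ge 0$ for all $p\in P$ and $x_{p_1}+\cdots+x_{p_k}\le 1$ for every chain $p_1<\cdots<p_k$ in $P$. A triangular $2$-face of a polytope is a $2$-dimensional face with exactly three vertices. The length of a chain $C$ is $|C|-1$, and $P$ is graded of rank $n$ if every maximal chain of $P$ has length $n$. The rank of an element $p$ is the maximal length of a chain with greatest element $p$, and $P_i$ denotes the set of elements of rank $i$. A graded poset is called maximal ranked if any two elements of distinct ranks are comparable. The poset $P$ contains an $X$-poset as a subposet if there are $a,b,c,d,e\in P$ with $a,b<c<d,e$ such that $a,b$ are incomparable and $d,e$ are incomparable. **Corollary.** Let $P$ be a finite maximal ranked poset of rank $n$ which contains an $X$-poset as a subposet. Then the number of triangular $2$-faces of $\mathcal{C}(P)$ is (finite and) equal to the (finite) number of triangular $2$-faces of $\mathcal{O}(P)$ plus $$\sum_{s=2}^{n}\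 \sum_{t=2}^{s}\ \sum_{m=2}^{|P_s|}\ \sum_{\ell=2}^{|P_{s-t}|}\binom{|P_s|}{m}\binom{|P_{s-t}|}{\ell}.$$ -/

import Mathlib

/-- The order polytope of `P`: points of `[0,1]^P` that are order reversing,
`x p ≥ x q` whenever `p ≤ q`. -/
def orderPolytope (P : Type*) [PartialOrder P] : Set (P → ℝ) :=
  {x | (∀ p, 0 ≤ x p ∧ x p ≤ 1) ∧ ∀ p q, p ≤ q → x q ≤ x p}

/-- The chain polytope of `P`: nonnegative points whose sum along every (finite) chain is
at most `1`. -/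
def chainPolytope (P : Type*) [PartialOrder P] : Set (P → ℝ) :=
  {x | (∀ p, 0 ≤ x p) ∧
    ∀ C : Finset P, IsChain (· ≤ ·) (C : Set P) → ∑ p ∈ C, x p ≤ 1}

/-- `F` is a face of the polytope `Q`: the nonempty set of points of `Q` at which some linear
functional attains its maximum over `Q` (the functional `0` gives `Q` itself). -/
def IsPolytopeFace {ι : Type*} (Q F : Set (ι → ℝ)) : Prop :=
  F.Nonempty ∧ IsExposed ℝ Q F

/-- The triangular 2-faces of a polytope `Q`: the faces of dimension `2` with exactly three
vertices. -/
def triangularTwoFaces {ι : Type*} (Q : Set (ι → ℝ)) : Set (Set (ι → ℝ)) :=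
  {F | IsPolytopeFace Q F ∧ Module.finrank ℝ (vectorSpan ℝ F) = 2 ∧
    (F.extremePoints ℝ).ncard = 3}

/-- `P` is graded of rank `n`: every maximal chain has length `n`, that is, `n + 1` elements. -/
def IsGradedOfRank (P : Type*) [PartialOrder P] (n : ℕ) : Prop :=
  ∀ C : Set P, IsMaxChain (· ≤ ·) C → C.ncard = n + 1

/-- The set of elements of rank `i` of `P`, the rank of `p` being the maximal length of a chain
with greatest element `p`. -/
def rankLevel (P : Type*) [PartialOrder P] (i : ℕ) : Set P :=
  {p | Order.height p = (i : ℕ∞)}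

/-- `P` is a maximal ranked poset of rank `n`: it is graded of rank `n` and any two elements of
distinct ranks are comparable. -/
def IsMaximalRanked (P : Type*) [PartialOrder P] (n : ℕ) : Prop :=
  IsGradedOfRank P n ∧
    ∀ i j : ℕ, i ≠ j → ∀ p ∈ rankLevel P i, ∀ q ∈ rankLevel P j, p ≤ q ∨ q ≤ p

/-- `P` contains an `X`-poset as a subposet: elements `a, b < c < d, e` with `a, b`
incomparable and `d, e` incomparable. -/
def ContainsXPoset (P : Type*) [PartialOrder P] : Prop :=
  ∃ a b c d e : P, (¬ a ≤ b ∧ ¬ b ≤ a) ∧ (¬ d ≤ e ∧ ¬ e ≤ d) ∧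
    a < c ∧ b < c ∧ c < d ∧ c < e

/-! Elements of distinct ranks are comparable, so p < q holds exactly when p has smaller rank than
q, and `P` is a stack of antichains. The vertices of both polytopes are then indexed by the same
objects, the subsets A of a single rank level, with ∅ included (`LevelSet`). In the chain polytope A
stands for itself as an antichain. In the order polytope it stands for the ideal made of A and all
lower levels.

In both polytopes the triangular faces are the triangles of the vertex graph
(`triangularTwoFaces_eq_image`). Nonadjacent vertices u, v satisfy u + v = u' + v' for another pair
(`chain_exchange`, `order_exchange`), so a functional maximal at u and v is maximal at u' and v'
too, which is impossible on a triangle. Conversely, three pairwise adjacent vertices are exactly the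
maximisers of a sum of suitable defining inequalities (`chain_face`, `order_face`).

The two graphs are nearly the same (`LevelAdj`). A and B are joined if B is A plus one element on
the same level, or if A lies on a lower level, with one exception: a B with at least two elements is
not joined to one exceptional set b. For the chain polytope b is ∅; for the order polytope b is the
full level just below B, because there the difference of the two ideals is the disconnected
antichain B.

Count triangles by their top vertex z (`ncard_levelAdj_triangles`). Everything is independent of the
choice of b, except that a big z loses as many triangles as b has edges among the vertices below the
level of z. For ∅ these edges go to the singletons. For the full level T below z they number, in
addition, the big sets strictly below T (`exceptionalDegree_order`). So the difference of the two
counts is the number of pairs of big sets at least two levels apart, which is the stated sum. -/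

section TriangularFaces
open Set

open Set

/-! ### Triangular faces of a polytope and triangles of its vertex graph -/

/-- A finite family of valid inequalities can be summed to a single functional that is tight
exactly where all of them are. -/
theorem exists_functional_of_family {E W J : Type*} [AddCommGroup E] [Module ℝ E] [Fintype J]
    (φ : W → E) (l : J → E →ₗ[ℝ] ℝ) (m : J → ℝ) (h : ∀ j w, l j (φ w) ≤ m j) :
    ∃ (k : E →ₗ[ℝ] ℝ) (M : ℝ), (∀ w, k (φ w) ≤ M) ∧
      ∀ w, k (φ w) = M ↔ ∀ j, l j (φ w) = m j := by
  refine ⟨∑ j, l j, ∑ j, m j, fun w => ?_, fun w => ?_⟩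
  · simpa using Finset.sum_le_sum fun j _ => h j w
  · rw [LinearMap.sum_apply, Finset.sum_eq_sum_iff_of_le fun j _ => h j w]
    simp

theorem eq_convexHull_of_finite_extremePoints {ι : Type*} [Finite ι] {F : Set (ι → ℝ)}
    (hc : Convex ℝ F) (hk : IsCompact F) (hf : (F.extremePoints ℝ).Finite) :
    F = convexHull ℝ (F.extremePoints ℝ) := by
  have h := closure_convexHull_extremePoints hk hc
  rwa [(hf.isCompact_convexHull (𝕜 := ℝ)).isClosed.closure_eq, eq_comm] at h

/-- Three distinct extreme points cannot be collinear, since one of them would lie between the other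
two. -/
theorem finrank_vectorSpan_of_extremePoints {ι : Type*} {Q : Set (ι → ℝ)} {a b c : ι → ℝ}
    (ha : a ∈ Q.extremePoints ℝ) (hb : b ∈ Q.extremePoints ℝ) (hc : c ∈ Q.extremePoints ℝ)
    (hab : a ≠ b) (hac : a ≠ c) (hbc : b ≠ c) :
    Module.finrank ℝ (vectorSpan ℝ (convexHull ℝ ({a, b, c} : Set (ι → ℝ)))) = 2 := by
  have key : ∀ {x y z : ι → ℝ}, x ∈ Q → z ∈ Q → y ∈ Q.extremePoints ℝ → x ≠ y → z ≠ y →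
      ¬ Wbtw ℝ x y z := by
    intro x y z hx hz hy hxy hzy hw
    rcases (mem_extremePoints_iff_forall_segment.1 hy).2 x hx z hz hw.mem_segment with h | h
    exacts [hxy h, hzy h]
  have hai : AffineIndependent ℝ ![a, b, c] := by
    rw [affineIndependent_iff_not_collinear_set]
    intro hcol
    rcases hcol.wbtw_or_wbtw_or_wbtw with h | h | h
    · exact key ha.1 hc.1 hb hab hbc.symm h
    · exact key hb.1 ha.1 hc hbc hac h
    · exact key hc.1 hb.1 ha hac.symm hab.symm h
  rw [← direction_affineSpan, affineSpan_convexHull, direction_affineSpan]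
  have := hai.finrank_vectorSpan (n := 2) (by simp)
  rwa [Matrix.range_cons, Matrix.range_cons, Matrix.range_cons, Matrix.range_empty,
    Set.union_empty, Set.singleton_union, Set.singleton_union] at this

theorem extremePoints_of_isExposed {ι : Type*} {Q F : Set (ι → ℝ)} (hF : IsExposed ℝ Q F) :
    F.extremePoints ℝ = F ∩ Q.extremePoints ℝ :=
  hF.isExtreme.extremePoints_eq

section
variable {ι W : Type*} {Q : Set (ι → ℝ)} {φ : W → ι → ℝ}

theorem isExposed_convexHull_triple [Finite ι] [Finite W] (hc : Convex ℝ Q) (hk : IsCompact Q)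
    (hext : Q.extremePoints ℝ = range φ) {x y z : W} {l : (ι → ℝ) →ₗ[ℝ] ℝ} {M : ℝ}
    (hle : ∀ w, l (φ w) ≤ M) (heq : ∀ w, l (φ w) = M ↔ w = x ∨ w = y ∨ w = z) :
    IsPolytopeFace Q (convexHull ℝ {φ x, φ y, φ z}) ∧
      (convexHull ℝ {φ x, φ y, φ z}).extremePoints ℝ = {φ x, φ y, φ z} := by
  have hfin : (Q.extremePoints ℝ).Finite := hext ▸ finite_range φ
  have hQ := eq_convexHull_of_finite_extremePoints hc hk hfin
  have hQM : ∀ p ∈ Q, l p ≤ M := by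
    intro p hp
    have hsub : convexHull ℝ (range φ) ⊆ {p | l p ≤ M} :=
      convexHull_min (by rintro _ ⟨w, rfl⟩; exact hle w) (convex_halfSpace_le l.isLinear M)
    rw [hQ, hext] at hp
    exact hsub hp
  have hmem : ∀ w, φ w ∈ Q := fun w => (hext ▸ mem_range_self w : φ w ∈ Q.extremePoints ℝ).1
  have hx : l (φ x) = M := (heq x).2 (Or.inl rfl)
  set F : Set (ι → ℝ) := {p ∈ Q | ∀ q ∈ Q, l q ≤ l p} with hFdef
  have hF : IsExposed ℝ Q F := fun _ => ⟨l.toContinuousLinearMap, rfl⟩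
  have hFM : ∀ p, p ∈ F ↔ p ∈ Q ∧ l p = M := by
    intro p
    refine ⟨fun h => ⟨h.1, le_antisymm (hQM p h.1) (hx ▸ h.2 _ (hmem x))⟩, fun h => ⟨h.1, ?_⟩⟩
    intro q hq
    rw [h.2]
    exact hQM q hq
  have hFe : F.extremePoints ℝ = {φ x, φ y, φ z} := by
    rw [extremePoints_of_isExposed hF, hext]
    ext p
    constructor
    · rintro ⟨hp, w, rfl⟩
      rcases (heq w).1 ((hFM _).1 hp).2 with rfl | rfl | rfl <;> simp
    · rintro (rfl | rfl | rfl)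
      · exact ⟨(hFM _).2 ⟨hmem _, hx⟩, mem_range_self _⟩
      · exact ⟨(hFM _).2 ⟨hmem _, (heq _).2 (by simp)⟩, mem_range_self _⟩
      · exact ⟨(hFM _).2 ⟨hmem _, (heq _).2 (by simp)⟩, mem_range_self _⟩
  have hFh : F = convexHull ℝ {φ x, φ y, φ z} := by
    rw [← hFe]
    exact eq_convexHull_of_finite_extremePoints (hF.convex hc) (hF.isCompact hk)
      (hFe ▸ Set.toFinite _)
  rw [← hFh]
  exact ⟨⟨⟨φ x, (hFM _).2 ⟨hmem x, hx⟩⟩, hF⟩, hFe⟩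

/-- A triangular face has pairwise adjacent vertices as soon as every nonadjacent pair of vertices
has the same sum as another pair. -/
theorem adj_of_mem_face (hext : Q.extremePoints ℝ = range φ) {adj : W → W → Prop}
    (hφ : Function.Injective φ)
    (hswap : ∀ x y, x ≠ y → ¬ adj x y → ¬ adj y x →
      ∃ x' y', x' ≠ x ∧ x' ≠ y ∧ φ x' + φ y' = φ x + φ y)
    {F : Set (ι → ℝ)} (hF : IsPolytopeFace Q F) {x y z : W}
    (he : F.extremePoints ℝ = {φ x, φ y, φ z}) (hxy : x ≠ y) : adj x y ∨ adj y x := by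
  by_contra! hcon
  obtain ⟨x', y', h1, h2, hsum⟩ := hswap x y hxy hcon.1 hcon.2
  have hmem : ∀ w, φ w ∈ Q.extremePoints ℝ := fun w => hext ▸ mem_range_self w
  have hinter := extremePoints_of_isExposed hF.2
  obtain ⟨l, hl⟩ := hF.2 hF.1
  have hx : φ x ∈ F := (he ▸ (by simp) : φ x ∈ F.extremePoints ℝ).1
  have hy : φ y ∈ F := (he ▸ (by simp) : φ y ∈ F.extremePoints ℝ).1
  have hxl : ∀ w, l (φ w) ≤ l (φ x) := fun w => ((hl ▸ hx :) : φ x ∈ _).2 _ (hmem w).1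
  have hyl : ∀ w, l (φ w) ≤ l (φ y) := fun w => ((hl ▸ hy :) : φ y ∈ _).2 _ (hmem w).1
  have hls : l (φ x') + l (φ y') = l (φ x) + l (φ y) := by rw [← map_add, hsum, map_add]
  have hface : ∀ w, l (φ w) = l (φ x) → w = x ∨ w = y ∨ w = z := by
    intro w hw
    have hwF : φ w ∈ F := by
      rw [hl]
      refine ⟨(hmem w).1, fun q hq => ?_⟩
      rw [hw]
      exact ((hl ▸ hx :) : φ x ∈ _).2 q hq
    have : φ w ∈ F.extremePoints ℝ := hinter ▸ ⟨hwF, hmem w⟩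
    rw [he] at this
    simpa [hφ.eq_iff] using this
  -- Both values are at most the maximum of `l`, and they add up to twice that maximum.
  have e1 : l (φ x') = l (φ x) := by linarith [hxl x', hxl y', hyl x', hyl y', hxl y, hyl x]
  have e2 : l (φ y') = l (φ x) := by linarith [hxl x', hxl y', hyl x', hyl y', hxl y, hyl x]
  rcases hface x' e1 with rfl | rfl | rfl
  · exact h1 rfl
  · exact h2 rfl
  rcases hface y' e2 with rfl | rfl | rfl
  · rw [add_comm] at hsum
    exact h2 (hφ (add_left_cancel hsum))
  · exact h1 (hφ (add_right_cancel hsum))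
  -- Here x' and y' are both the third vertex, which would be the midpoint of the other two.
  have hseg : φ y' ∈ segment ℝ (φ x) (φ y) := by
    refine ⟨1 / 2, 1 / 2, by norm_num, by norm_num, by norm_num, ?_⟩
    rw [← smul_add, ← hsum, ← two_smul ℝ (φ y'), smul_smul]
    norm_num
  rcases (mem_extremePoints_iff_forall_segment.1 (hmem y')).2 _ (hmem x).1 _ (hmem y).1 hseg
    with h | h
  · exact h1 (hφ h).symm
  · exact h2 (hφ h).symm

variable [Finite ι] [Finite W] (hc : Convex ℝ Q) (hk : IsCompact Q) (hφ : Function.Injective φ)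
    (hext : Q.extremePoints ℝ = range φ) (adj : W → W → Prop) (ρ : W → ℕ)
    (hρ : ∀ x y, adj x y → ρ x < ρ y)
    (hswap : ∀ x y, x ≠ y → ¬ adj x y → ¬ adj y x →
      ∃ x' y', x' ≠ x ∧ x' ≠ y ∧ φ x' + φ y' = φ x + φ y)
    (hface : ∀ x y z, adj x y → adj y z → adj x z →
      ∃ (l : (ι → ℝ) →ₗ[ℝ] ℝ) (M : ℝ), (∀ w, l (φ w) ≤ M) ∧
        ∀ w, l (φ w) = M ↔ w = x ∨ w = y ∨ w = z)
include hc hk hφ hext hρ hswap hface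

/-- The triangular faces of a polytope correspond to the triangles of its graph, each written as
an increasing triple. -/
theorem triangularTwoFaces_eq_image :
    triangularTwoFaces Q =
      (fun t : W × W × W => convexHull ℝ {φ t.1, φ t.2.1, φ t.2.2}) ''
        {t | adj t.1 t.2.1 ∧ adj t.2.1 t.2.2 ∧ adj t.1 t.2.2} := by
  have hmem : ∀ w, φ w ∈ Q.extremePoints ℝ := fun w => hext ▸ mem_range_self w
  ext F
  constructor
  · rintro ⟨hF, -, h3⟩
    have hinter := extremePoints_of_isExposed hF.2
    obtain ⟨a, b, c, hab, hac, hbc, he⟩ := ncard_eq_three.1 h3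
    have hr : ∀ p ∈ F.extremePoints ℝ, p ∈ range φ := fun p hp => hext ▸ (hinter ▸ hp).2
    obtain ⟨x, rfl⟩ := hr a (by simp [he])
    obtain ⟨y, rfl⟩ := hr b (by simp [he])
    obtain ⟨z, rfl⟩ := hr c (by simp [he])
    have hFh : F = convexHull ℝ {φ x, φ y, φ z} := by
      rw [← he]
      exact eq_convexHull_of_finite_extremePoints (hF.2.convex hc) (hF.2.isCompact hk)
        (he ▸ Set.toFinite _)
    have p1 : ({φ x, φ y, φ z} : Set (ι → ℝ)) = {φ x, φ z, φ y} := by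
      rw [pair_comm (φ y)]
    have p2 : ({φ x, φ y, φ z} : Set (ι → ℝ)) = {φ y, φ x, φ z} := insert_comm _ _ _
    have p3 : ({φ x, φ y, φ z} : Set (ι → ℝ)) = {φ y, φ z, φ x} := by
      rw [p2, pair_comm (φ x)]
    have p4 : ({φ x, φ y, φ z} : Set (ι → ℝ)) = {φ z, φ x, φ y} := by
      rw [p1, insert_comm]
    have p5 : ({φ x, φ y, φ z} : Set (ι → ℝ)) = {φ z, φ y, φ x} := by
      rw [p4, pair_comm (φ x)]
    have a1 := adj_of_mem_face hext hφ hswap hF he (ne_of_apply_ne φ hab)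
    have a2 := adj_of_mem_face hext hφ hswap hF (he.trans p1) (ne_of_apply_ne φ hac)
    have a3 := adj_of_mem_face hext hφ hswap hF (he.trans p3) (ne_of_apply_ne φ hbc)
    rcases a1 with a1 | a1 <;> rcases a2 with a2 | a2 <;> rcases a3 with a3 | a3
    · exact ⟨(x, y, z), ⟨a1, a3, a2⟩, hFh.symm⟩
    · exact ⟨(x, z, y), ⟨a2, a3, a1⟩, (hFh.trans (by rw [p1])).symm⟩
    -- A cyclic orientation of the triangle is excluded by the monotone parameter `ρ`.
    · have := hρ _ _ a1; have := hρ _ _ a2; have := hρ _ _ a3; omega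
    · exact ⟨(z, x, y), ⟨a2, a1, a3⟩, (hFh.trans (by rw [p4])).symm⟩
    · exact ⟨(y, x, z), ⟨a1, a2, a3⟩, (hFh.trans (by rw [p2])).symm⟩
    · have := hρ _ _ a1; have := hρ _ _ a2; have := hρ _ _ a3; omega
    · exact ⟨(y, z, x), ⟨a3, a2, a1⟩, (hFh.trans (by rw [p3])).symm⟩
    · exact ⟨(z, y, x), ⟨a3, a1, a2⟩, (hFh.trans (by rw [p5])).symm⟩
  · rintro ⟨⟨x, y, z⟩, ⟨hxy, hyz, hxz⟩, rfl⟩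
    obtain ⟨l, M, hle, heq⟩ := hface x y z hxy hyz hxz
    have hne : ∀ {u v}, adj u v → φ u ≠ φ v := fun {u v} h e =>
      (hρ u v h).ne (congrArg ρ (hφ e))
    obtain ⟨h1, h2⟩ := isExposed_convexHull_triple hc hk hext hle heq
    refine ⟨h1, finrank_vectorSpan_of_extremePoints (hmem x) (hmem y) (hmem z)
      (hne hxy) (hne hxz) (hne hyz), ?_⟩
    rw [h2]
    exact ncard_eq_three.2 ⟨_, _, _, hne hxy, hne hxz, hne hyz, rfl⟩

/-- A face determines its vertex set, and `ρ` increases along each triple, so the vertex set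
determines the triple. -/
theorem triangularTwoFaces_finite_and_ncard :
    (triangularTwoFaces Q).Finite ∧ (triangularTwoFaces Q).ncard =
      {t : W × W × W | adj t.1 t.2.1 ∧ adj t.2.1 t.2.2 ∧ adj t.1 t.2.2}.ncard := by
  rw [triangularTwoFaces_eq_image hc hk hφ hext adj ρ hρ hswap hface]
  refine ⟨(Set.toFinite _).image _, InjOn.ncard_image ?_⟩
  rintro ⟨x, y, z⟩ ⟨hxy, hyz, hxz⟩ ⟨x', y', z'⟩ ⟨hxy', hyz', hxz'⟩ h
  obtain ⟨l, M, hle, heq⟩ := hface x y z hxy hyz hxz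
  obtain ⟨l', M', hle', heq'⟩ := hface x' y' z' hxy' hyz' hxz'
  have h1 := (isExposed_convexHull_triple hc hk hext hle heq).2
  have h2 := (isExposed_convexHull_triple hc hk hext hle' heq').2
  simp only at h hxy hyz hxz hxy' hyz' hxz'
  rw [h, h2] at h1
  have hw : ∀ w, (w = x' ∨ w = y' ∨ w = z') ↔ (w = x ∨ w = y ∨ w = z) := by
    intro w
    simpa [hφ.eq_iff] using Set.ext_iff.1 h1 (φ w)
  have := hρ _ _ hxy; have := hρ _ _ hyz; have := hρ _ _ hxy'; have := hρ _ _ hyz'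
  have ex := (hw x).2 (by simp)
  have ey := (hw y).2 (by simp)
  have ez := (hw z).2 (by simp)
  rcases ex with rfl | rfl | rfl <;> rcases ey with rfl | rfl | rfl <;>
    rcases ez with rfl | rfl | rfl <;> first | rfl | omega

end

/-! ### Counting triangles in a levelled graph -/

/-- A relation on a levelled set: covers inside a level, together with all pairs of increasing
level, except that a big element is not related to the exceptional element below its level. -/
def LevelAdj {W : Type*} (L : W → ℕ) (cov : W → W → Prop) (big : W → Prop) (b : ℕ → W)
    (x y : W) : Prop :=
  cov x y ∨ (L x < L y ∧ (¬ big y ∨ x ≠ b (L y)))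

section LevelCount
open Classical
variable {W : Type*} [Fintype W] (L : W → ℕ) (cov : W → W → Prop) (big : W → Prop) (b : ℕ → W)

/-- The number of related pairs of elements of level below `k` that involve `b k`. -/
noncomputable def exceptionalDegree (k : ℕ) : ℤ :=
  ∑ y, if L y < k then ∑ x, if LevelAdj L cov big b x y then
    ((if x = b k then 1 else 0) + (if y = b k then 1 else 0) : ℤ) else 0 else 0

variable (hcL : ∀ x y, cov x y → L x = L y) (hcb : ∀ x y, cov x y → big y)
  (hcc : ∀ x y z, cov x y → cov y z → ¬ cov x z) (hb : ∀ y, big y → L (b (L y)) < L y)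
include hcL hb

/-- A big `y` loses exactly one neighbour below, because by `hb` its exceptional element really lies
on a lower level. The count therefore does not depend on which element is exceptional. -/
theorem sum_levelAdj_left (y : W) :
    (∑ x, if LevelAdj L cov big b x y then (1 : ℤ) else 0) =
      (∑ x, if cov x y then (1 : ℤ) else 0) + (∑ x, if L x < L y then (1 : ℤ) else 0) -
        if big y then 1 else 0 := by
  have h1 : (if big y then (1 : ℤ) else 0) =
      ∑ x, if big y ∧ x = b (L y) then (1 : ℤ) else 0 := by
    by_cases h : big y <;> simp [h]
  rw [h1, ← Finset.sum_add_distrib, ← Finset.sum_sub_distrib]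
  refine Finset.sum_congr rfl fun x _ => ?_
  have e1 := hcL x y
  have e2 := hb y
  unfold LevelAdj
  by_cases h2 : cov x y
  · have := e1 h2
    have h3 : ¬ (big y ∧ x = b (L y)) := by
      rintro ⟨h, rfl⟩
      have := e2 h
      omega
    simp [h2, h3, this]
  · by_cases h3 : big y
    · by_cases h4 : x = b (L y)
      · have := e2 h3
        rw [← h4] at this
        simp [h2, h3, ← h4, this]
      · simp [h2, h3, h4]
    · simp [h2, h3]

include hcb hcc

/-- With the top vertex fixed, a middle vertex covered by `z` allows every lower `x` but the
exceptional one, since covers do not compose. A middle vertex on a lower level allows every edge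
from `x` to `y`, except, for big `z`, those with an end at the exceptional element. -/
theorem sum_levelAdj_triangle (z : W) :
    (∑ y, ∑ x, if LevelAdj L cov big b x y ∧ LevelAdj L cov big b y z ∧ LevelAdj L cov big b x z
      then (1 : ℤ) else 0) =
    (∑ y, if cov y z then (∑ x, if L x < L z then (1 : ℤ) else 0) - 1 else 0) +
    (∑ y, if L y < L z then (∑ x, if LevelAdj L cov big b x y then (1 : ℤ) else 0) else 0) -
      if big z then exceptionalDegree L cov big b (L z) else 0 := by
  have h1 : (if big z then exceptionalDegree L cov big b (L z) else 0) =
      ∑ y, if L y < L z ∧ big z then ∑ x, if LevelAdj L cov big b x y then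
        ((if x = b (L z) then 1 else 0) + (if y = b (L z) then 1 else 0) : ℤ) else 0 else 0 := by
    by_cases h : big z <;> simp [h, exceptionalDegree]
  rw [h1, ← Finset.sum_add_distrib, ← Finset.sum_sub_distrib]
  refine Finset.sum_congr rfl fun y _ => ?_
  by_cases hyz : cov y z
  · have hL := hcL y z hyz
    have hz := hcb y z hyz
    have hbz := hb z hz
    have h2 : (1 : ℤ) = ∑ x, if x = b (L z) then (1 : ℤ) else 0 := by simp
    rw [if_pos hyz, if_neg (by omega), if_neg (by omega), add_zero, sub_zero]
    conv_rhs => rw [h2]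
    rw [← Finset.sum_sub_distrib]
    refine Finset.sum_congr rfl fun x _ => ?_
    have a1 : (LevelAdj L cov big b x y ∧ LevelAdj L cov big b y z ∧ LevelAdj L cov big b x z) ↔
        L x < L z ∧ x ≠ b (L z) := by
      constructor
      · rintro ⟨hxy | hxy, -, hxz | hxz⟩
        · exact absurd hxz (hcc x y z hxy hyz)
        · have := hcL x y hxy; omega
        · have := hcL x z hxz; omega
        · exact ⟨hxz.1, hxz.2.resolve_left (not_not.2 hz)⟩
      · rintro ⟨h3, h4⟩
        exact ⟨Or.inr ⟨hL ▸ h3, Or.inr (hL ▸ h4)⟩, Or.inl hyz, Or.inr ⟨h3, Or.inr h4⟩⟩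
    rw [if_congr a1 rfl rfl]
    by_cases h3 : x = b (L z)
    · simp [h3, hbz]
    · simp [h3]
  · rw [if_neg hyz, zero_add]
    by_cases hyL : L y < L z
    · rw [if_pos hyL]
      by_cases hz : big z
      · have hbz := hb z hz
        rw [if_pos ⟨hyL, hz⟩, ← Finset.sum_sub_distrib]
        refine Finset.sum_congr rfl fun x _ => ?_
        by_cases hxy : LevelAdj L cov big b x y
        · have hne : x ≠ y := by
            rintro rfl
            rcases hxy with h | h
            · exact hcc x x x h h h
            · exact absurd h.1 (lt_irrefl _)
          have hxL : L x < L z := by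
            rcases hxy with h | h
            · have := hcL x y h; omega
            · have := h.1; omega
          have hxz : ¬ cov x z := fun h => by have := hcL x z h; omega
          by_cases h3 : x = b (L z)
          -- The ends of an edge are distinct, so the two indicators in `exceptionalDegree` never
          -- count it twice.
          · have h4 : y ≠ b (L z) := fun h => hne (h3.trans h.symm)
            have hxz' : ¬ LevelAdj L cov big b x z := by
              rintro (h | h)
              exacts [hxz h, h.2.elim (absurd hz) (absurd h3)]
            rw [if_pos hxy, if_pos h3, if_neg h4, if_neg fun h => hxz' h.2.2]
            simp [hxy]
          · by_cases h4 : y = b (L z)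
            · have hyz' : ¬ LevelAdj L cov big b y z := by
                rintro (h | h)
                exacts [hyz h, h.2.elim (absurd hz) (absurd h4)]
              rw [if_pos hxy, if_neg h3, if_pos h4, if_neg fun h => hyz' h.2.1]
              simp [hxy]
            · have e1 : LevelAdj L cov big b y z := Or.inr ⟨hyL, Or.inr h4⟩
              have e2 : LevelAdj L cov big b x z := Or.inr ⟨hxL, Or.inr h3⟩
              simp [hxy, e1, e2, h3, h4]
        · simp [hxy]
      · rw [if_neg (fun h => hz h.2), sub_zero]
        refine Finset.sum_congr rfl fun x _ => ?_
        refine if_congr ⟨fun h => h.1, fun h => ⟨h, Or.inr ⟨hyL, Or.inl hz⟩, Or.inr ⟨?_, Or.inl hz⟩⟩⟩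
          rfl rfl
        rcases h with h | h
        · have := hcL x y h; omega
        · have := h.1; omega
    · have hyz' : ¬ LevelAdj L cov big b y z := by
        rintro (h | h)
        exacts [hyz h, hyL h.1]
      rw [if_neg hyL, if_neg (fun h => hyL h.1)]
      simp [hyz']

/-- Up to the exceptional degrees, the number of triangles does not depend on the choice of the
exceptional elements. -/
theorem ncard_levelAdj_triangles :
    (({t : W × W × W | LevelAdj L cov big b t.1 t.2.1 ∧ LevelAdj L cov big b t.2.1 t.2.2 ∧
        LevelAdj L cov big b t.1 t.2.2}.ncard : ℕ) : ℤ) =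
      (∑ z, ((∑ y, if cov y z then (∑ x, if L x < L z then (1 : ℤ) else 0) - 1 else 0) +
        ∑ y, if L y < L z then ((∑ x, if cov x y then (1 : ℤ) else 0) +
          (∑ x, if L x < L y then (1 : ℤ) else 0) - if big y then 1 else 0) else 0)) -
      ∑ z, if big z then exceptionalDegree L cov big b (L z) else 0 := by
  have h1 : (({t : W × W × W | LevelAdj L cov big b t.1 t.2.1 ∧ LevelAdj L cov big b t.2.1 t.2.2 ∧
        LevelAdj L cov big b t.1 t.2.2}.ncard : ℕ) : ℤ) = ∑ z, ∑ y, ∑ x,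
      if LevelAdj L cov big b x y ∧ LevelAdj L cov big b y z ∧ LevelAdj L cov big b x z
      then (1 : ℤ) else 0 := by
    rw [Set.ncard_eq_toFinset_card', Set.toFinset_ofPred, Finset.card_filter, Nat.cast_sum,
      Fintype.sum_prod_type_right, Fintype.sum_prod_type_right]
    push_cast
    rfl
  rw [h1, ← Finset.sum_sub_distrib]
  refine Finset.sum_congr rfl fun z _ => ?_
  rw [sum_levelAdj_triangle L cov big b hcL hcb hcc hb]
  simp_rw [sum_levelAdj_left L cov big b hcL hb]

end LevelCount

/-! ### Vertices of the order and chain polytopes -/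

section Polytopes
open Classical

/-- The `0/1` vector of a finite set. -/
noncomputable def indicatorVector {P : Type*} (s : Finset P) : P → ℝ :=
  fun p => if p ∈ s then 1 else 0

theorem indicatorVector_injective {P : Type*} :
    Function.Injective (indicatorVector : Finset P → P → ℝ) := by
  intro s t h
  ext p
  have := congrFun h p
  by_cases hs : p ∈ s <;> by_cases ht : p ∈ t <;> simp_all [indicatorVector]

theorem exists_indicatorVector_eq {P : Type*} [Finite P] {x : P → ℝ}
    (h : ∀ p, x p = 0 ∨ x p = 1) : ∃ s : Finset P, indicatorVector s = x := by
  have := Fintype.ofFinite P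
  refine ⟨Finset.univ.filter fun p => x p = 1, ?_⟩
  ext p
  rcases h p with h | h <;> simp [indicatorVector, h]

theorem mem_extremePoints_of_zero_one {P : Type*} {Q : Set (P → ℝ)}
    (hQ : ∀ x ∈ Q, ∀ p, 0 ≤ x p ∧ x p ≤ 1) {x : P → ℝ} (hx : x ∈ Q)
    (h01 : ∀ p, x p = 0 ∨ x p = 1) : x ∈ Q.extremePoints ℝ := by
  rw [mem_extremePoints_iff_left]
  refine ⟨hx, fun y hy z hz hxyz => ?_⟩
  obtain ⟨a, b, ha, hb, hab, rfl⟩ := hxyz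
  ext p
  have hy' := hQ y hy p
  have hz' := hQ z hz p
  rcases h01 p with h | h <;> simp only [Pi.add_apply, Pi.smul_apply, smul_eq_mul] at h ⊢
  · have h1 : 0 ≤ b * z p := mul_nonneg hb.le hz'.1
    have h2 : 0 ≤ a * y p := mul_nonneg ha.le hy'.1
    have h3 : a * y p = 0 := by linarith
    rw [h]
    exact (mul_eq_zero.1 h3).resolve_left ha.ne'
  · have h1 : b * z p ≤ b * 1 := mul_le_mul_of_nonneg_left hz'.2 hb.le
    have h2 : a * y p ≤ a * 1 := mul_le_mul_of_nonneg_left hy'.2 ha.le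
    have h3 : a * (y p - 1) = 0 := by linarith
    rw [h]
    linarith [(mul_eq_zero.1 h3).resolve_left ha.ne']

theorem eq_of_mem_extremePoints_of_add_eq {E : Type*} [AddCommGroup E] [Module ℝ E] {Q : Set E}
    {x y z : E} (hx : x ∈ Q.extremePoints ℝ) (hy : y ∈ Q) (hz : z ∈ Q) (h : y + z = x + x) :
    y = x := by
  refine (mem_extremePoints_iff_left.1 hx).2 y hy z hz
    ⟨1 / 2, 1 / 2, by norm_num, by norm_num, by norm_num, ?_⟩
  rw [← smul_add, h, ← two_smul ℝ x, smul_smul]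
  norm_num

variable {P : Type*} [PartialOrder P]

theorem convex_orderPolytope : Convex ℝ (orderPolytope P) := by
  rintro x ⟨hx, hx'⟩ y ⟨hy, hy'⟩ a b ha hb hab
  refine ⟨fun p => ⟨?_, ?_⟩, fun p q hpq => ?_⟩ <;>
    simp only [Pi.add_apply, Pi.smul_apply, smul_eq_mul]
  · exact add_nonneg (mul_nonneg ha (hx p).1) (mul_nonneg hb (hy p).1)
  · nlinarith [(hx p).2, (hy p).2]
  · nlinarith [hx' p q hpq, hy' p q hpq]

theorem isCompact_orderPolytope : IsCompact (orderPolytope P) := by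
  refine (isCompact_Icc (a := (0 : P → ℝ)) (b := 1)).of_isClosed_subset ?_
    fun x hx => ⟨fun p => (hx.1 p).1, fun p => (hx.1 p).2⟩
  simp only [orderPolytope, ofPred_and, ofPred_forall]
  refine IsClosed.inter (isClosed_iInter fun p => IsClosed.inter ?_ ?_)
    (isClosed_iInter fun p => isClosed_iInter fun q => isClosed_iInter fun _ => ?_)
  · exact isClosed_le continuous_const (continuous_apply p)
  · exact isClosed_le (continuous_apply p) continuous_const
  · exact isClosed_le (continuous_apply q) (continuous_apply p)

theorem le_one_of_mem_chainPolytope {x : P → ℝ} (hx : x ∈ chainPolytope P) (p : P) :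
    x p ≤ 1 := by
  simpa using hx.2 {p} (by simp)

theorem convex_chainPolytope : Convex ℝ (chainPolytope P) := by
  rintro x ⟨hx, hx'⟩ y ⟨hy, hy'⟩ a b ha hb hab
  refine ⟨fun p => ?_, fun C hC => ?_⟩ <;>
    simp only [Pi.add_apply, Pi.smul_apply, smul_eq_mul]
  · exact add_nonneg (mul_nonneg ha (hx p)) (mul_nonneg hb (hy p))
  · rw [Finset.sum_add_distrib, ← Finset.mul_sum, ← Finset.mul_sum]
    nlinarith [hx' C hC, hy' C hC]

theorem isCompact_chainPolytope : IsCompact (chainPolytope P) := by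
  refine (isCompact_Icc (a := (0 : P → ℝ)) (b := 1)).of_isClosed_subset ?_
    fun x hx => ⟨hx.1, le_one_of_mem_chainPolytope hx⟩
  simp only [chainPolytope, ofPred_and, ofPred_forall]
  refine IsClosed.inter (isClosed_iInter fun p => ?_)
    (isClosed_iInter fun C => isClosed_iInter fun _ => ?_)
  · exact isClosed_le continuous_const (continuous_apply p)
  · exact isClosed_le (continuous_finsetSum C fun p _ => continuous_apply p) continuous_const

theorem indicatorVector_mem_orderPolytope {s : Finset P} (hs : IsLowerSet (s : Set P)) :
    indicatorVector s ∈ orderPolytope P := by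
  refine ⟨fun p => ?_, fun p q hpq => ?_⟩
  · by_cases h : p ∈ s <;> simp [indicatorVector, h]
  · have := @hs q p hpq
    by_cases h : q ∈ s
    · have h' : p ∈ s := this h
      simp [indicatorVector, h, h']
    · by_cases h' : p ∈ s <;> simp [indicatorVector, h, h']

theorem extremePoints_orderPolytope [Finite P] :
    (orderPolytope P).extremePoints ℝ =
      indicatorVector '' {s : Finset P | IsLowerSet (s : Set P)} := by
  ext x
  constructor
  · intro hx
    obtain ⟨h1, h2⟩ := hx.1
    -- The maps u ↦ u² and u ↦ 2u - u² are monotone self-maps of [0,1] with average u. Extremality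
    -- forces x² = x, so all coordinates are 0 or 1.
    have hy : (fun p => x p ^ 2) ∈ orderPolytope P := by
      refine ⟨fun p => ⟨sq_nonneg _, pow_le_one₀ (h1 p).1 (h1 p).2⟩, fun p q hpq => ?_⟩
      exact pow_le_pow_left₀ (h1 q).1 (h2 p q hpq) 2
    have hz : (fun p => 2 * x p - x p ^ 2) ∈ orderPolytope P := by
      refine ⟨fun p => ⟨?_, ?_⟩, fun p q hpq => ?_⟩ <;> simp only
      · nlinarith [(h1 p).1, (h1 p).2]
      · nlinarith [sq_nonneg (1 - x p)]
      · nlinarith [h2 p q hpq, (h1 p).2, (h1 q).2]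
    have he := eq_of_mem_extremePoints_of_add_eq hx hy hz (by ext p; simp; ring)
    have h01 : ∀ p, x p = 0 ∨ x p = 1 := fun p => by
      have h : x p ^ 2 = x p := congrFun he p
      have : x p * (x p - 1) = 0 := by linarith
      rcases mul_eq_zero.1 this with h | h
      · exact Or.inl h
      · exact Or.inr (by linarith)
    obtain ⟨s, rfl⟩ := exists_indicatorVector_eq h01
    refine ⟨s, fun p q hqp hp => ?_, rfl⟩
    have := h2 q p hqp
    by_contra hq
    have hp' : p ∈ s := hp
    have hq' : q ∉ s := hq
    simp [indicatorVector, hp', hq'] at this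
    linarith
  · rintro ⟨s, hs, rfl⟩
    refine mem_extremePoints_of_zero_one (fun x hx => hx.1) (indicatorVector_mem_orderPolytope hs)
      fun p => ?_
    by_cases h : p ∈ s <;> simp [indicatorVector, h]

/-- A set all of whose elements have the same value under `r`. -/
def IsHomogeneous (r : P → ℕ) (A : Finset P) : Prop := ∀ p ∈ A, ∀ q ∈ A, r p = r q

section Ranked
variable {r : P → ℕ} (hr : ∀ p q, p < q ↔ r p < r q)
include hr

theorem isChain_injOn {C : Finset P} (hC : IsChain (· ≤ ·) (C : Set P)) : InjOn r C := by
  intro p hp q hq h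
  by_contra hne
  rcases hC hp hq hne with h' | h'
  · have := (hr p q).1 (lt_of_le_of_ne h' hne); omega
  · have := (hr q p).1 (lt_of_le_of_ne h' (Ne.symm hne)); omega

theorem indicatorVector_mem_chainPolytope {A : Finset P} (hA : IsHomogeneous r A) :
    indicatorVector A ∈ chainPolytope P := by
  refine ⟨fun p => by by_cases h : p ∈ A <;> simp [indicatorVector, h], fun C hC => ?_⟩
  simp only [indicatorVector, Finset.sum_boole]
  have : (C.filter (· ∈ A)).card ≤ 1 := by
    refine Finset.card_le_one.2 fun p hp q hq => ?_
    rw [Finset.mem_filter] at hp hq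
    exact isChain_injOn hr hC hp.1 hq.1 (hA p hp.2 q hq.2)
  exact_mod_cast this

/-- Scaling the levels of a point of the chain polytope keeps it inside as long as the weighted
sum of the level maxima stays at most `1`. -/
theorem exists_level_maxima [Finite P] [Nonempty P] {x : P → ℝ} (hx : x ∈ chainPolytope P) :
    ∃ (R : Finset ℕ) (m : ℕ → ℝ), (∀ p, r p ∈ R) ∧ (∀ p, x p ≤ m (r p)) ∧
      (∀ p, ∃ q, r q = r p ∧ x q = m (r p)) ∧
      ∀ t : ℕ → ℝ, (∀ i, 0 ≤ t i) → ∑ i ∈ R, t i * m i ≤ 1 →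
        (fun p => t (r p) * x p) ∈ chainPolytope P ∧ ∑ i ∈ R, m i ≤ 1 := by
  have := Fintype.ofFinite P
  have hmax : ∀ i ∈ Finset.univ.image r, ∃ q, r q = i ∧ ∀ p, r p = i → x p ≤ x q := by
    intro i hi
    obtain ⟨p, -, hp⟩ := Finset.mem_image.1 hi
    obtain ⟨q, hq, hq'⟩ := Finset.exists_max_image (Finset.univ.filter fun p => r p = i) x
      ⟨p, by simpa using hp⟩
    exact ⟨q, by simpa using hq, fun p hp => hq' p (by simpa using hp)⟩
  choose! σ hσ hσ' using hmax
  have hR : ∀ p, r p ∈ Finset.univ.image r := fun p => Finset.mem_image_of_mem r (Finset.mem_univ p)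
  have hm : ∀ p, x p ≤ x (σ (r p)) := fun p => hσ' _ (hR p) p rfl
  have hm0 : ∀ i, 0 ≤ x (σ i) := fun i => hx.1 _
  refine ⟨Finset.univ.image r, fun i => x (σ i), hR, hm,
    fun p => ⟨σ (r p), hσ _ (hR p), rfl⟩, fun t ht hsum => ⟨⟨fun p => mul_nonneg (ht _) (hx.1 p),
      fun C hC => ?_⟩, ?_⟩⟩
  -- A chain meets each level at most once, so its sum is bounded by the sum of the level maxima.
  · refine le_trans ?_ hsum
    calc ∑ p ∈ C, t (r p) * x p ≤ ∑ p ∈ C, t (r p) * x (σ (r p)) :=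
          Finset.sum_le_sum fun p _ => mul_le_mul_of_nonneg_left (hm p) (ht _)
      _ = ∑ i ∈ C.image r, t i * x (σ i) :=
          (Finset.sum_image (f := fun i => t i * x (σ i)) (isChain_injOn hr hC)).symm
      _ ≤ _ := Finset.sum_le_sum_of_subset_of_nonneg
          (Finset.image_subset_image (Finset.subset_univ C))
          fun i _ _ => mul_nonneg (ht i) (hm0 i)
  -- One maximiser from each level together form a chain, to which the defining inequality applies.
  · have hinj : InjOn σ (Finset.univ.image r : Finset ℕ) := fun i hi j hj h => by
      rw [← hσ i hi, h, hσ j hj]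
    rw [← Finset.sum_image (f := x) hinj]
    refine hx.2 _ ?_
    intro p hp q hq hne
    rw [Finset.mem_coe, Finset.mem_image] at hp hq
    obtain ⟨i, hi, rfl⟩ := hp
    obtain ⟨j, hj, rfl⟩ := hq
    have h1 : r (σ i) ≠ r (σ j) := by
      rw [hσ i hi, hσ j hj]
      rintro rfl
      exact hne rfl
    rcases lt_or_gt_of_ne h1 with h | h
    · exact Or.inl ((hr _ _).2 h).le
    · exact Or.inr ((hr _ _).2 h).le

/-- An extreme point is supported on one level, because otherwise weight can be moved between two
levels in both directions. On a single level the squaring argument used for the order polytope makes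
it a 0/1 vector. -/
theorem extremePoints_chainPolytope [Finite P] :
    (chainPolytope P).extremePoints ℝ = indicatorVector '' {A : Finset P | IsHomogeneous r A} := by
  ext x
  constructor
  · intro hx
    have hx0 := hx.1.1
    have hx1 := le_one_of_mem_chainPolytope hx.1
    have hone : ∀ p q, 0 < x p → 0 < x q → r p = r q := by
      intro p q hp hq
      by_contra hne
      have : Nonempty P := ⟨p⟩
      obtain ⟨R, m, hR, hxm, hmx, hscale⟩ := exists_level_maxima hr hx.1
      have hm1 : ∑ i ∈ R, m i ≤ 1 := (hscale 0 (fun _ => le_rfl) (by simp)).2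
      have hmp : 0 < m (r p) := hp.trans_le (hxm p)
      have hmq : 0 < m (r q) := hq.trans_le (hxm q)
      obtain ⟨p', hp'r, hp'x⟩ := hmx p
      obtain ⟨q', hq'r, hq'x⟩ := hmx q
      have hmp1 : m (r p) ≤ 1 := hp'x ▸ hx1 p'
      have hmq1 : m (r q) ≤ 1 := hq'x ▸ hx1 q'
      -- Scale level `r p` by 1 + e·m(r q) and level `r q` by 1 - e·m(r p): the weighted sum of
      -- level maxima does not change, and since the maxima are at most 1 the factors stay
      -- nonnegative.
      have hmem : ∀ e : ℝ, e = 1 ∨ e = -1 →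
          (fun u => (1 + e * (if r u = r p then m (r q) else 0) -
            e * (if r u = r q then m (r p) else 0)) * x u) ∈ chainPolytope P := by
        intro e he
        refine (hscale (fun i => 1 + e * (if i = r p then m (r q) else 0) -
            e * (if i = r q then m (r p) else 0)) (fun i => ?_) ?_).1
        · by_cases h1 : i = r p
          · have h2 : i ≠ r q := fun h => hne (h1.symm.trans h)
            rcases he with rfl | rfl <;> simp only [if_pos h1, if_neg h2] <;> linarith
          · by_cases h2 : i = r q
            · rcases he with rfl | rfl <;> simp only [if_neg h1, if_pos h2] <;> linarith
            · simp [h1, h2]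
        · have hs : ∑ i ∈ R, (1 + e * (if i = r p then m (r q) else 0) -
              e * (if i = r q then m (r p) else 0)) * m i = ∑ i ∈ R, m i := by
            have h3 : ∀ i ∈ R, (1 + e * (if i = r p then m (r q) else 0) -
                e * (if i = r q then m (r p) else 0)) * m i =
                m i + (if i = r p then e * (m (r q) * m (r p)) else 0) -
                  (if i = r q then e * (m (r q) * m (r p)) else 0) := by
              intro i _
              by_cases h1 : i = r p
              · have h2 : i ≠ r q := fun h => hne (h1.symm.trans h)
                simp only [if_pos h1, if_neg h2]; rw [h1]; ring
              · by_cases h2 : i = r q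
                · simp only [if_neg h1, if_pos h2]; rw [h2]; ring
                · simp only [if_neg h1, if_neg h2]; ring
            rw [Finset.sum_congr rfl h3, Finset.sum_sub_distrib, Finset.sum_add_distrib]
            simp [hR]
          rw [hs]
          exact hm1
      have he := eq_of_mem_extremePoints_of_add_eq hx (hmem 1 (Or.inl rfl)) (hmem (-1) (Or.inr rfl))
        (by ext u; simp only [Pi.add_apply]; ring)
      have := congrFun he p
      simp only [if_pos, if_neg hne] at this
      nlinarith [mul_pos hmq hp]
    have hsq : ∀ f : ℝ → ℝ, f 0 = 0 → (∀ u, 0 ≤ u → u ≤ 1 → 0 ≤ f u ∧ f u ≤ 1) →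
        (fun p => f (x p)) ∈ chainPolytope P := by
      intro f hf0 hf
      refine ⟨fun p => (hf _ (hx0 p) (hx1 p)).1, fun C hC => ?_⟩
      by_cases h : ∃ p ∈ C, 0 < x p
      · obtain ⟨p, hp, hpx⟩ := h
        rw [Finset.sum_eq_single_of_mem p hp]
        · exact (hf _ (hx0 p) (hx1 p)).2
        · intro q hq hqp
          rcases (hx0 q).eq_or_lt with h | h
          · rw [← h, hf0]
          · exact absurd (isChain_injOn hr hC hq hp (hone q p h hpx)) hqp
      · push Not at h
        rw [Finset.sum_eq_zero]
        · norm_num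
        · intro p hp
          rw [le_antisymm (h p hp) (hx0 p), hf0]
    have he := eq_of_mem_extremePoints_of_add_eq hx
      (hsq (fun u => u ^ 2) (by norm_num) fun u h0 h1 => ⟨sq_nonneg _, pow_le_one₀ h0 h1⟩)
      (hsq (fun u => 2 * u - u ^ 2) (by norm_num) fun u h0 h1 =>
        ⟨by nlinarith, by nlinarith [sq_nonneg (1 - u)]⟩) (by ext p; simp; ring)
    have h01 : ∀ p, x p = 0 ∨ x p = 1 := fun p => by
      have h : x p ^ 2 = x p := congrFun he p
      have : x p * (x p - 1) = 0 := by linarith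
      rcases mul_eq_zero.1 this with h | h
      · exact Or.inl h
      · exact Or.inr (by linarith)
    obtain ⟨s, rfl⟩ := exists_indicatorVector_eq h01
    exact ⟨s, fun p hp q hq => hone p q (by simp [indicatorVector, hp])
      (by simp [indicatorVector, hq]), rfl⟩
  · rintro ⟨s, hs, rfl⟩
    refine mem_extremePoints_of_zero_one
      (fun x hx p => ⟨hx.1 p, le_one_of_mem_chainPolytope hx p⟩)
      (indicatorVector_mem_chainPolytope hr hs) fun p => ?_
    by_cases h : p ∈ s <;> simp [indicatorVector, h]

end Ranked
end Polytopes

/-! ### Level sets, their ideals, and exchanges between nonadjacent vertices -/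

section Levels
open Classical
variable {P : Type*}

/-- Subsets of the levels of `r`. -/
abbrev LevelSet (r : P → ℕ) := {A : Finset P // IsHomogeneous r A}

namespace LevelSet
variable {r : P → ℕ}

/-- One more than the level containing `A`, and `0` if `A` is empty. -/
def depth (A : LevelSet r) : ℕ := A.1.sup fun p => r p + 1

theorem depth_eq {A : LevelSet r} {p : P} (hp : p ∈ A.1) : depth A = r p + 1 :=
  le_antisymm (Finset.sup_le fun q hq => by rw [A.2 q hq p hp])
    (Finset.le_sup (f := fun p => r p + 1) hp)

theorem depth_of_eq_empty {A : LevelSet r} (h : A.1 = ∅) : depth A = 0 := by simp [depth, h]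

theorem nonempty_of_depth_pos {A : LevelSet r} (h : 0 < depth A) : A.1.Nonempty := by
  by_contra hn
  rw [Finset.not_nonempty_iff_eq_empty] at hn
  rw [depth_of_eq_empty hn] at h
  exact lt_irrefl _ h

/-- `B` arises from `A` by adding one element of the same level. -/
def Cov (A B : LevelSet r) : Prop := depth A = depth B ∧ A.1 ⊆ B.1 ∧ B.1.card = A.1.card + 1

/-- The level set has at least two elements. -/
def Big (A : LevelSet r) : Prop := 1 < A.1.card

/-- The empty level set. -/
def bot (r : P → ℕ) : LevelSet r := ⟨∅, fun p hp => absurd hp (Finset.notMem_empty p)⟩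

theorem Cov.nonempty {A B : LevelSet r} (h : Cov A B) : A.1.Nonempty := by
  have hB : B.1.Nonempty := by
    rw [← Finset.card_pos, h.2.2]
    exact Nat.succ_pos _
  obtain ⟨q, hq⟩ := hB
  refine nonempty_of_depth_pos ?_
  rw [h.1, depth_eq hq]
  exact Nat.succ_pos _

theorem Cov.big {A B : LevelSet r} (h : Cov A B) : Big B := by
  have := h.nonempty.card_pos
  have := h.2.2
  unfold Big
  omega

theorem Cov.not_cov_trans {A B C : LevelSet r} (h : Cov A B) (h' : Cov B C) : ¬ Cov A C := by
  intro h''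
  have := h.2.2
  have := h'.2.2
  have := h''.2.2
  omega

theorem Big.nonempty {A : LevelSet r} (h : Big A) : A.1.Nonempty :=
  Finset.card_pos.1 (lt_trans Nat.zero_lt_one h)

theorem Big.depth_pos {A : LevelSet r} (h : Big A) : 0 < depth A := by
  obtain ⟨p, hp⟩ := h.nonempty
  rw [depth_eq hp]
  exact Nat.succ_pos _

theorem eq_of_subset_of_subset_of_cov {A B w : LevelSet r} (h : Cov A B) (h1 : A.1 ⊆ w.1)
    (h2 : w.1 ⊆ B.1) : w = A ∨ w = B := by
  have := Finset.card_le_card h1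
  have := Finset.card_le_card h2
  have := h.2.2
  rcases Nat.eq_or_lt_of_le (Finset.card_le_card h1) with h3 | h3
  · exact Or.inl (Subtype.ext (Finset.eq_of_subset_of_card_le h1 h3.ge).symm)
  · exact Or.inr (Subtype.ext (Finset.eq_of_subset_of_card_le h2 (by omega)))

variable [Fintype P]

/-- A common monotone parameter for the relations `LevelAdj`. -/
def weight (A : LevelSet r) : ℕ := depth A * (Fintype.card P + 1) + A.1.card

/-- `weight` compares by depth and then by cardinality: the factor `Fintype.card P + 1` exceeds
every cardinality. -/
theorem weight_lt_of_levelAdj {b : ℕ → LevelSet r} {A B : LevelSet r}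
    (h : LevelAdj depth Cov Big b A B) : weight A < weight B := by
  unfold weight
  rcases h with h | h
  · rw [h.1, h.2.2]
    omega
  · have h1 := Nat.mul_le_mul_right (Fintype.card P + 1) (Nat.succ_le_of_lt h.1)
    have h2 := Finset.card_le_univ A.1
    rw [Nat.succ_mul] at h1
    omega

variable (r) in
/-- The full level just below the level of depth `k`. -/
def fullBelow (k : ℕ) : LevelSet r :=
  -- Depth k means rank k - 1, so the level below has rank k - 2. Writing this as an addition makes
  -- the set empty for k ≤ 1, so that ∅ is the exceptional set for the bottom level.
  ⟨Finset.univ.filter fun p => r p + 2 = k, fun p hp q hq => by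
    simp only [Finset.mem_filter] at hp hq; omega⟩

theorem mem_fullBelow {k : ℕ} {p : P} : p ∈ (fullBelow r k).1 ↔ r p + 2 = k := by
  simp [fullBelow]

theorem depth_fullBelow_lt {k : ℕ} (hk : 0 < k) : depth (fullBelow r k) < k := by
  rcases (fullBelow r k).1.eq_empty_or_nonempty with h | ⟨p, hp⟩
  · rwa [depth_of_eq_empty h]
  · rw [depth_eq hp]
    rw [mem_fullBelow] at hp
    omega

/-- The order ideal generated by `A` together with all lower levels. -/
noncomputable def ideal (A : LevelSet r) : Finset P := A.1 ∪ Finset.univ.filter fun p => r p + 1 < depth A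

theorem mem_ideal {A : LevelSet r} {p : P} : p ∈ ideal A ↔ p ∈ A.1 ∨ r p + 1 < depth A := by
  simp [ideal]

theorem le_depth_of_mem_ideal {A : LevelSet r} {p : P} (h : p ∈ ideal A) : r p + 1 ≤ depth A := by
  rcases mem_ideal.1 h with h | h
  · exact (depth_eq h).ge
  · exact h.le

theorem mem_of_mem_ideal {A : LevelSet r} {p : P} (h : p ∈ ideal A) (h' : r p + 1 = depth A) :
    p ∈ A.1 := (mem_ideal.1 h).resolve_right h'.not_lt

theorem ideal_injective : Function.Injective (ideal : LevelSet r → Finset P) := by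
  have key : ∀ {A B : LevelSet r}, ideal A = ideal B → depth A ≤ depth B := by
    intro A B h
    by_contra! hlt
    obtain ⟨q, hq⟩ := nonempty_of_depth_pos (Nat.zero_lt_of_lt hlt)
    have := le_depth_of_mem_ideal (h ▸ mem_ideal.2 (Or.inl hq) : q ∈ ideal B)
    rw [depth_eq hq] at hlt
    omega
  intro A B h
  have hd := le_antisymm (key h) (key h.symm)
  refine Subtype.ext (Finset.ext fun p => ⟨fun hp => ?_, fun hp => ?_⟩)
  · exact mem_of_mem_ideal (h ▸ mem_ideal.2 (Or.inl hp)) (by rw [← hd, depth_eq hp])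
  · exact mem_of_mem_ideal (h ▸ mem_ideal.2 (Or.inl hp)) (by rw [hd, depth_eq hp])

variable [PartialOrder P] (hr : ∀ p q, p < q ↔ r p < r q)
include hr

theorem isLowerSet_ideal (A : LevelSet r) : IsLowerSet (ideal A : Set P) := by
  intro p q hqp hp
  rcases hqp.eq_or_lt with rfl | hlt
  · exact hp
  · have := (hr q p).1 hlt
    have := le_depth_of_mem_ideal hp
    exact mem_ideal.2 (Or.inr (by omega))

/-- The required level set is the top-rank part of `s`; by `hr` every element of smaller rank lies
below it. -/
theorem exists_ideal_eq {s : Finset P} (hs : IsLowerSet (s : Set P)) :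
    ∃ A : LevelSet r, ideal A = s := by
  rcases s.eq_empty_or_nonempty with rfl | hne
  · refine ⟨bot r, Finset.eq_empty_of_forall_notMem fun p hp => ?_⟩
    have := le_depth_of_mem_ideal hp
    rw [depth_of_eq_empty rfl] at this
    omega
  · obtain ⟨m, hm, hmax⟩ := Finset.exists_max_image s r hne
    let A : LevelSet r := ⟨s.filter fun p => r p = r m, fun p hp q hq => by
      rw [(Finset.mem_filter.1 hp).2, (Finset.mem_filter.1 hq).2]⟩
    have hmA : m ∈ A.1 := Finset.mem_filter.2 ⟨hm, rfl⟩
    refine ⟨A, Finset.ext fun p => ?_⟩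
    rw [mem_ideal, depth_eq hmA]
    constructor
    · rintro (h | h)
      · exact (Finset.mem_filter.1 h).1
      · exact hs ((hr p m).2 (by omega)).le hm
    · intro hp
      rcases (hmax p hp).eq_or_lt with h | h
      · exact Or.inl (Finset.mem_filter.2 ⟨hp, h⟩)
      · exact Or.inr (by omega)

end LevelSet

theorem indicatorVector_exchange {s t : Finset P} {p : P} (hs : p ∈ s) (ht : p ∉ t) :
    indicatorVector (s.erase p) + indicatorVector (insert p t) =
      indicatorVector s + indicatorVector t := by
  ext q
  by_cases h : q = p
  · subst h
    simp [indicatorVector, hs, ht]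
  · simp [indicatorVector, h]

/-- Move one element p of the symmetric difference from one set to the other. The sum of the
indicators is kept, and `h1`, `h2` exclude the degenerate case in which the move merely swaps the
two sets. -/
theorem exists_exchange {W : Type*} {g : W → Finset P} (hg : Function.Injective g) {x y : W}
    (hxy : x ≠ y) (h1 : ∀ p, p ∉ g x → g y ≠ insert p (g x))
    (h2 : ∀ p, p ∉ g y → g x ≠ insert p (g y))
    (h3 : ∀ p ∈ g x, p ∉ g y → (∃ v, g v = (g x).erase p) ∧ ∃ v, g v = insert p (g y))
    (h4 : ∀ p ∈ g y, p ∉ g x → (∃ v, g v = (g y).erase p) ∧ ∃ v, g v = insert p (g x)) :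
    ∃ x' y', x' ≠ x ∧ x' ≠ y ∧ indicatorVector (g x') + indicatorVector (g y') =
      indicatorVector (g x) + indicatorVector (g y) := by
  by_cases h : ∃ p ∈ g x, p ∉ g y
  · obtain ⟨p, hp, hp'⟩ := h
    obtain ⟨⟨v, hv⟩, ⟨w, hw⟩⟩ := h3 p hp hp'
    refine ⟨v, w, ?_, ?_, by rw [hv, hw, indicatorVector_exchange hp hp']⟩
    · rintro rfl
      rw [hv] at hp
      exact Finset.notMem_erase _ _ hp
    · rintro rfl
      refine h2 p hp' ?_
      rw [hv, Finset.insert_erase hp]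
  · push Not at h
    have : ∃ p ∈ g y, p ∉ g x := by
      by_contra! h'
      exact hxy (hg (Finset.Subset.antisymm h h'))
    obtain ⟨p, hp, hp'⟩ := this
    obtain ⟨⟨v, hv⟩, ⟨w, hw⟩⟩ := h4 p hp hp'
    refine ⟨v, w, ?_, ?_, by rw [hv, hw, indicatorVector_exchange hp hp', add_comm]⟩
    · rintro rfl
      refine h1 p hp' ?_
      rw [hv, Finset.insert_erase hp]
    · rintro rfl
      rw [hv] at hp
      exact Finset.notMem_erase _ _ hp

namespace LevelSet
variable {r : P → ℕ}

/-- Adjacency of vertices of the chain polytope. -/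
abbrev ChainAdj (A B : LevelSet r) : Prop := LevelAdj depth Cov Big (fun _ => bot r) A B

/-- Adjacency of vertices of the order polytope. -/
abbrev OrderAdj [Fintype P] (A B : LevelSet r) : Prop := LevelAdj depth Cov Big (fullBelow r) A B

/-- On different levels, nonadjacency leaves only the exceptional case where the lower set is empty.
So all subsets of the union are again vertices, and every exchange is available. -/
theorem isHomogeneous_union_of_not_chainAdj {A B : LevelSet r} (h : ¬ ChainAdj A B)
    (h' : ¬ ChainAdj B A) : IsHomogeneous r (A.1 ∪ B.1) := by
  have key : ∀ {A B : LevelSet r}, ¬ ChainAdj A B → depth A < depth B → A.1 = ∅ := by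
    intro A B h hlt
    by_contra hne
    exact h (Or.inr ⟨hlt, Or.inr fun h => hne (by rw [h]; rfl)⟩)
  rcases lt_trichotomy (depth A) (depth B) with hlt | heq | hlt
  · rw [key h hlt, Finset.empty_union]
    exact B.2
  · have hd : ∀ p ∈ A.1 ∪ B.1, r p + 1 = depth A := by
      intro p hp
      rcases Finset.mem_union.1 hp with hp | hp
      · exact (depth_eq hp).symm
      · rw [heq, depth_eq hp]
    intro p hp q hq
    have := hd p hp
    have := hd q hq
    omega
  · rw [key h' hlt, Finset.union_empty]
    exact A.2

theorem chainAdj_of_eq_insert {A B : LevelSet r} {p : P} (hp : p ∉ A.1)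
    (h : B.1 = insert p A.1) : ChainAdj A B := by
  have hpB : p ∈ B.1 := h ▸ Finset.mem_insert_self _ _
  have hc : B.1.card = A.1.card + 1 := by rw [h, Finset.card_insert_of_notMem hp]
  rcases A.1.eq_empty_or_nonempty with he | ⟨q, hq⟩
  · refine Or.inr ⟨?_, Or.inl ?_⟩
    · rw [depth_of_eq_empty he, depth_eq hpB]
      exact Nat.succ_pos _
    · rw [Big, hc, he]
      simp
  · have hqB : q ∈ B.1 := h ▸ Finset.mem_insert_of_mem hq
    exact Or.inl ⟨by rw [depth_eq hq, depth_eq hqB], h ▸ Finset.subset_insert _ _, hc⟩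

theorem chain_exchange {A B : LevelSet r} (hAB : A ≠ B) (h : ¬ ChainAdj A B)
    (h' : ¬ ChainAdj B A) : ∃ A' B' : LevelSet r, A' ≠ A ∧ A' ≠ B ∧
      indicatorVector A'.1 + indicatorVector B'.1 = indicatorVector A.1 + indicatorVector B.1 := by
  have hU := isHomogeneous_union_of_not_chainAdj h h'
  have hsub : ∀ s : Finset P, s ⊆ A.1 ∪ B.1 → ∃ v : LevelSet r, v.1 = s := fun s hs =>
    ⟨⟨s, fun p hp q hq => hU p (hs hp) q (hs hq)⟩, rfl⟩
  refine exists_exchange Subtype.val_injective hAB (fun p hp he => h (chainAdj_of_eq_insert hp he))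
    (fun p hp he => h' (chainAdj_of_eq_insert hp he)) (fun p hp _ => ⟨hsub _ ?_, hsub _ ?_⟩)
    (fun p hp _ => ⟨hsub _ ?_, hsub _ ?_⟩)
  · exact (Finset.erase_subset _ _).trans Finset.subset_union_left
  · exact Finset.insert_subset (Finset.mem_union_left _ hp) Finset.subset_union_right
  · exact (Finset.erase_subset _ _).trans Finset.subset_union_right
  · exact Finset.insert_subset (Finset.mem_union_right _ hp) Finset.subset_union_left

section Order
variable [Fintype P]

theorem orderAdj_of_ideal_eq_insert {A B : LevelSet r} {p : P} (hp : p ∉ ideal A)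
    (h : ideal B = insert p (ideal A)) : OrderAdj A B := by
  rcases lt_trichotomy (depth A) (depth B) with hlt | heq | hlt
  · refine Or.inr ⟨hlt, Or.inl fun hbig => ?_⟩
    have hsub : B.1 ⊆ {p} := by
      intro q hq
      have hq' : q ∈ insert p (ideal A) := h ▸ mem_ideal.2 (Or.inl hq)
      rcases Finset.mem_insert.1 hq' with rfl | hq'
      · exact Finset.mem_singleton_self _
      · have := le_depth_of_mem_ideal hq'
        rw [depth_eq hq] at hlt
        omega
    have := Finset.card_le_card hsub
    rw [Finset.card_singleton] at this
    exact absurd hbig (not_lt.2 this)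
  · have hpA : p ∉ A.1 := fun h' => hp (mem_ideal.2 (Or.inl h'))
    have hB : B.1 = insert p A.1 := by
      ext q
      constructor
      · intro hq
        have hq' : q ∈ insert p (ideal A) := h ▸ mem_ideal.2 (Or.inl hq)
        rcases Finset.mem_insert.1 hq' with rfl | hq'
        · exact Finset.mem_insert_self _ _
        · exact Finset.mem_insert_of_mem (mem_of_mem_ideal hq' (by rw [heq, depth_eq hq]))
      · intro hq
        rcases Finset.mem_insert.1 hq with rfl | hq
        · have hq : q ∈ ideal B := h ▸ Finset.mem_insert_self _ _
          refine (mem_ideal.1 hq).resolve_right fun h' => hp (mem_ideal.2 (Or.inr ?_))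
          rwa [heq]
        · refine mem_of_mem_ideal ?_ (by rw [← heq, depth_eq hq])
          rw [h]
          exact Finset.mem_insert_of_mem (mem_ideal.2 (Or.inl hq))
    refine Or.inl ⟨heq, hB ▸ Finset.subset_insert _ _, ?_⟩
    rw [hB, Finset.card_insert_of_notMem hpA]
  · obtain ⟨q, hq⟩ := nonempty_of_depth_pos (Nat.zero_lt_of_lt hlt)
    have := le_depth_of_mem_ideal (A := B)
      (h ▸ Finset.mem_insert_of_mem (mem_ideal.2 (Or.inl hq)) : q ∈ ideal B)
    rw [depth_eq hq] at hlt
    omega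

variable (hs : ∀ p k, k < r p → ∃ q, r q = k)
include hs

/-- Two nonadjacent ideals differ only on a single level. If the depths differ, the lower set is the
full level just below the upper one, and `hs` guarantees that this level is inhabited when it is
needed. -/
theorem rank_eq_of_not_orderAdj {A B : LevelSet r} (h : ¬ OrderAdj A B) (h' : ¬ OrderAdj B A)
    {p : P} (hp : (p ∈ ideal A ∧ p ∉ ideal B) ∨ (p ∈ ideal B ∧ p ∉ ideal A)) :
    r p + 1 = max (depth A) (depth B) := by
  have key : ∀ {A B : LevelSet r}, ¬ OrderAdj A B → depth A < depth B →
      (p ∈ ideal A ∧ p ∉ ideal B) ∨ (p ∈ ideal B ∧ p ∉ ideal A) → r p + 1 = depth B := by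
    intro A B h hlt hp
    have hAb : A = fullBelow r (depth B) := by
      by_contra hne
      exact h (Or.inr ⟨hlt, Or.inr hne⟩)
    rcases hp with ⟨h1, h2⟩ | ⟨h1, h2⟩
    · have := le_depth_of_mem_ideal h1
      exact absurd (mem_ideal.2 (Or.inr (by omega))) h2
    · by_contra hne
      have h3 := le_depth_of_mem_ideal h1
      obtain ⟨u, hu⟩ := nonempty_of_depth_pos (Nat.zero_lt_of_lt hlt)
      have h4 := depth_eq hu
      obtain ⟨q, hq⟩ := hs u (r u - 1) (by omega)
      have hqA : q ∈ A.1 := by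
        rw [hAb, mem_fullBelow]
        omega
      have h5 := depth_eq hqA
      have h6 : ¬ (r p + 1 < depth A) := fun h' => h2 (mem_ideal.2 (Or.inr h'))
      refine h2 (mem_ideal.2 (Or.inl ?_))
      rw [hAb, mem_fullBelow]
      omega
  rcases lt_trichotomy (depth A) (depth B) with hlt | heq | hlt
  · rw [max_eq_right hlt.le]
    exact key h hlt hp
  · rw [heq, max_self]
    rcases hp with ⟨h1, h2⟩ | ⟨h1, h2⟩
    · have := le_depth_of_mem_ideal h1
      have : ¬ (r p + 1 < depth B) := fun h' => h2 (mem_ideal.2 (Or.inr h'))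
      omega
    · have := le_depth_of_mem_ideal h1
      have : ¬ (r p + 1 < depth A) := fun h' => h2 (mem_ideal.2 (Or.inr h'))
      omega
  · rw [max_eq_left hlt.le]
    exact key h' hlt hp.symm

variable [PartialOrder P] (hr : ∀ p q, p < q ↔ r p < r q)
include hr

/-- All elements in the symmetric difference have the same rank, so none lies below another. Hence
erasing one from one ideal, or inserting it into the other, leaves a lower set. -/
theorem order_exchange {A B : LevelSet r} (hAB : A ≠ B) (h : ¬ OrderAdj A B)
    (h' : ¬ OrderAdj B A) : ∃ A' B' : LevelSet r, A' ≠ A ∧ A' ≠ B ∧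
      indicatorVector (ideal A') + indicatorVector (ideal B') =
        indicatorVector (ideal A) + indicatorVector (ideal B) := by
  have key : ∀ {A B : LevelSet r}, ¬ OrderAdj A B → ¬ OrderAdj B A → ∀ p ∈ ideal A, p ∉ ideal B →
      (∃ v : LevelSet r, ideal v = (ideal A).erase p) ∧
        ∃ v : LevelSet r, ideal v = insert p (ideal B) := by
    intro A B h h' p hpA hpB
    have hp := rank_eq_of_not_orderAdj hs h h' (Or.inl ⟨hpA, hpB⟩)
    have hA := isLowerSet_ideal hr A
    have hB := isLowerSet_ideal hr B
    constructor <;> apply exists_ideal_eq hr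
    · intro q u huq hq
      rw [Finset.mem_coe, Finset.mem_erase] at hq ⊢
      refine ⟨?_, hA huq hq.2⟩
      rintro rfl
      have hlt := (hr u q).1 (lt_of_le_of_ne huq (Ne.symm hq.1))
      by_cases hqB : q ∈ ideal B
      · exact hpB (hB huq hqB)
      · have := rank_eq_of_not_orderAdj hs h h' (Or.inl ⟨hq.2, hqB⟩)
        omega
    · intro q u huq hq
      rw [Finset.mem_coe, Finset.mem_insert] at hq ⊢
      rcases hq with rfl | hq
      · rcases huq.eq_or_lt with rfl | hlt
        · exact Or.inl rfl
        · refine Or.inr ?_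
          by_contra huB
          have := rank_eq_of_not_orderAdj hs h h' (Or.inl ⟨hA huq hpA, huB⟩)
          have := (hr u q).1 hlt
          omega
      · exact Or.inr (hB huq hq)
  exact exists_exchange ideal_injective hAB (fun p hp he => h (orderAdj_of_ideal_eq_insert hp he))
    (fun p hp he => h' (orderAdj_of_ideal_eq_insert hp he)) (key h h') (key h' h)

end Order
end LevelSet
end Levels

/-! ### Exposing the face spanned by a triangle -/

section Faces
open Classical
variable {P : Type*} [PartialOrder P]

theorem sum_indicatorVector {P : Type*} (K A : Finset P) :
    ∑ u ∈ K, indicatorVector A u = ((K.filter (· ∈ A)).card : ℝ) := by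
  simp only [indicatorVector, Finset.sum_boole]

namespace LevelSet

theorem rank_ne_of_depth_lt {P : Type*} {r : P → ℕ} {A B : LevelSet r} (h : depth A < depth B) {p q : P} (hp : p ∈ A.1)
    (hq : q ∈ B.1) : r p ≠ r q := by
  rw [depth_eq hp, depth_eq hq] at h
  omega

variable {r : P → ℕ} (hr : ∀ p q, p < q ↔ r p < r q)
include hr

/-- A functional on the chain polytope whose maximal vertices are those supported on the union of
three given vertices and meeting all chains that meet these three. -/
theorem exists_chain_functional [Fintype P] (x y z : LevelSet r) :
    ∃ (l : (P → ℝ) →ₗ[ℝ] ℝ) (M : ℝ), (∀ w : LevelSet r, l (indicatorVector w.1) ≤ M) ∧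
      ∀ w : LevelSet r, l (indicatorVector w.1) = M ↔
        (∀ p ∈ w.1, p ∈ x.1 ∨ p ∈ y.1 ∨ p ∈ z.1) ∧
        ∀ K : Finset P, IsChain (· ≤ ·) (K : Set P) → (∃ u ∈ K, u ∈ x.1) → (∃ u ∈ K, u ∈ y.1) →
          (∃ u ∈ K, u ∈ z.1) → ∃ u ∈ K, u ∈ w.1 := by
  let good : Finset P → Prop := fun K => IsChain (· ≤ ·) (K : Set P) ∧ (∃ u ∈ K, u ∈ x.1) ∧
    (∃ u ∈ K, u ∈ y.1) ∧ ∃ u ∈ K, u ∈ z.1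
  -- The family combines nonnegativity at the points outside the three supports with the chain
  -- inequality for each chain meeting all three sets.
  let l : P ⊕ Finset P → (P → ℝ) →ₗ[ℝ] ℝ := Sum.elim
    (fun p => if p ∈ x.1 ∨ p ∈ y.1 ∨ p ∈ z.1 then 0 else -LinearMap.proj p)
    (fun K => if good K then ∑ u ∈ K, LinearMap.proj u else 0)
  let m : P ⊕ Finset P → ℝ := Sum.elim (fun _ => 0) (fun K => if good K then 1 else 0)
  have hle1 : ∀ (K : Finset P) (w : LevelSet r), good K →
      ∑ u ∈ K, indicatorVector w.1 u ≤ 1 := fun K w hK =>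
    (indicatorVector_mem_chainPolytope hr w.2).2 K hK.1
  obtain ⟨k, M, h1, h2⟩ := exists_functional_of_family
    (fun w : LevelSet r => indicatorVector w.1) l m (by
      rintro (p | K) w
      · by_cases h : p ∈ x.1 ∨ p ∈ y.1 ∨ p ∈ z.1
        · simp [l, m, h]
        · by_cases hw : p ∈ w.1 <;> simp [l, m, h, indicatorVector, hw]
      · by_cases h : good K
        · simpa [l, m, h] using hle1 K w h
        · simp [l, m, h])
  refine ⟨k, M, h1, fun w => (h2 w).trans ⟨fun h => ⟨fun p hp => ?_, fun K hK hx hy hz => ?_⟩,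
    fun h => ?_⟩⟩
  · by_contra hn
    have := h (Sum.inl p)
    simp [l, m, hn, indicatorVector, hp] at this
  · have hg : good K := ⟨hK, hx, hy, hz⟩
    have := h (Sum.inr K)
    simp only [l, m, Sum.elim_inr, if_pos hg, LinearMap.sum_apply, LinearMap.proj_apply,
      sum_indicatorVector] at this
    have hc : 0 < (K.filter (· ∈ w.1)).card := by
      have h3 : (K.filter (· ∈ w.1)).card = 1 := by exact_mod_cast this
      omega
    obtain ⟨u, hu⟩ := Finset.card_pos.1 hc
    exact ⟨u, (Finset.mem_filter.1 hu).1, (Finset.mem_filter.1 hu).2⟩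
  · rintro (p | K)
    · by_cases hn : p ∈ x.1 ∨ p ∈ y.1 ∨ p ∈ z.1
      · simp [l, m, hn]
      · have hw : p ∉ w.1 := fun hw => hn (h.1 p hw)
        simp [l, m, hn, indicatorVector, hw]
    · by_cases hg : good K
      · simp only [l, m, Sum.elim_inr, if_pos hg, LinearMap.sum_apply, LinearMap.proj_apply]
        refine le_antisymm (hle1 K w hg) ?_
        obtain ⟨u, hu, huw⟩ := h.2 K hg.1 hg.2.1 hg.2.2.1 hg.2.2.2
        rw [sum_indicatorVector]
        have : 0 < (K.filter (· ∈ w.1)).card :=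
          Finset.card_pos.2 ⟨u, Finset.mem_filter.2 ⟨hu, huw⟩⟩
        exact_mod_cast this
      · simp [l, m, hg]

theorem le_or_le_of_rank_ne {p q : P} (h : r p ≠ r q) : p ≤ q ∨ q ≤ p :=
  (lt_or_gt_of_ne h).imp (fun h => ((hr _ _).2 h).le) (fun h => ((hr _ _).2 h).le)

theorem isChain_pair {p q : P} (h : r p ≠ r q) :
    IsChain (· ≤ ·) (({p, q} : Finset P) : Set P) := by
  intro a ha b hb hne
  rw [Finset.mem_coe, Finset.mem_insert, Finset.mem_singleton] at ha hb
  rcases ha with rfl | rfl <;> rcases hb with rfl | rfl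
  · exact absurd rfl hne
  · exact le_or_le_of_rank_ne hr h
  · exact le_or_le_of_rank_ne hr h.symm
  · exact absurd rfl hne

theorem isChain_triple {p q s : P} (h1 : r p ≠ r q) (h2 : r q ≠ r s) (h3 : r p ≠ r s) :
    IsChain (· ≤ ·) (({p, q, s} : Finset P) : Set P) := by
  intro a ha b hb hne
  rw [Finset.mem_coe, Finset.mem_insert, Finset.mem_insert, Finset.mem_singleton] at ha hb
  rcases ha with rfl | rfl | rfl <;> rcases hb with rfl | rfl | rfl <;>
    first
    | exact absurd rfl hne
    | exact le_or_le_of_rank_ne hr (by assumption)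
    | exact le_or_le_of_rank_ne hr (Ne.symm (by assumption))

theorem chain_face [Fintype P] {x y z : LevelSet r} (hxy : ChainAdj x y) (hyz : ChainAdj y z)
    (hxz : ChainAdj x z) :
    ∃ (l : (P → ℝ) →ₗ[ℝ] ℝ) (M : ℝ), (∀ w : LevelSet r, l (indicatorVector w.1) ≤ M) ∧
      ∀ w : LevelSet r, l (indicatorVector w.1) = M ↔ w = x ∨ w = y ∨ w = z := by
  obtain ⟨l, M, h1, h2⟩ := exists_chain_functional hr x y z
  refine ⟨l, M, h1, fun w => (h2 w).trans ⟨?_, ?_⟩⟩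
  swap
  · rintro (rfl | rfl | rfl)
    · exact ⟨fun p hp => Or.inl hp, fun K _ h _ _ => h⟩
    · exact ⟨fun p hp => Or.inr (Or.inl hp), fun K _ _ h _ => h⟩
    · exact ⟨fun p hp => Or.inr (Or.inr hp), fun K _ _ _ h => h⟩
  rintro ⟨hsub, hK⟩
  have hne : ∀ {A B : LevelSet r}, ChainAdj A B → A.1.Nonempty → B.1.Nonempty := by
    rintro A B (h | h) ⟨p, hp⟩
    · exact ⟨p, h.2.1 hp⟩
    · exact nonempty_of_depth_pos (Nat.zero_lt_of_lt h.1)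
  have hemp : ∀ {B : LevelSet r}, ChainAdj x B → x.1 = ∅ → ∃ p, B.1 = {p} := by
    rintro B (h | h) hx
    · obtain ⟨p, hp⟩ := h.nonempty
      simp [hx] at hp
    · have hB := nonempty_of_depth_pos (Nat.zero_lt_of_lt h.1)
      have hxb : x = bot r := Subtype.ext hx
      have hB' := h.2.resolve_right (not_not.2 hxb)
      refine Finset.card_eq_one.1 ?_
      have := hB.card_pos
      unfold Big at hB'
      omega
  rcases x.1.eq_empty_or_nonempty with hx | hx
  -- No chain meets the empty set, so only the support condition remains. Both neighbours are
  -- singletons on different levels, and the face is the triangle with vertices 0, e_p, e_q.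
  · obtain ⟨p, hp⟩ := hemp hxy hx
    obtain ⟨q, hq⟩ := hemp hxz hx
    have hpy : p ∈ y.1 := by simp [hp]
    have hqz : q ∈ z.1 := by simp [hq]
    have hlt : depth y < depth z := by
      rcases hyz with h | h
      · have := h.2.2
        rw [hp, hq] at this
        simp at this
      · exact h.1
    have hpq := rank_ne_of_depth_lt hlt hpy hqz
    have hw : ∀ u ∈ w.1, u = p ∨ u = q := fun u hu => by
      simpa [hx, hp, hq] using hsub u hu
    by_cases hpw : p ∈ w.1
    · refine Or.inr (Or.inl (Subtype.ext ?_))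
      rw [hp, Finset.eq_singleton_iff_unique_mem]
      refine ⟨hpw, fun u hu => (hw u hu).resolve_right ?_⟩
      rintro rfl
      exact hpq (w.2 _ hpw _ hu)
    · by_cases hqw : q ∈ w.1
      · refine Or.inr (Or.inr (Subtype.ext ?_))
        rw [hq, Finset.eq_singleton_iff_unique_mem]
        refine ⟨hqw, fun u hu => (hw u hu).resolve_left ?_⟩
        rintro rfl
        exact hpw hu
      · refine Or.inl (Subtype.ext ?_)
        rw [hx]
        refine Finset.eq_empty_of_forall_notMem fun u hu => ?_
        rcases hw u hu with rfl | rfl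
        exacts [hpw hu, hqw hu]
  have hy := hne hxy hx
  have hz := hne hxz hx
  rcases hxy with cxy | ⟨lxy, -⟩
  · have lyz : depth y < depth z := by
      rcases hyz with cyz | h
      · rcases hxz with cxz | h
        · exact absurd cxz (cxy.not_cov_trans cyz)
        · exact absurd (cxy.1.trans cyz.1) h.1.ne
      · exact h.1
    have lxz : depth x < depth z := cxy.1 ▸ lyz
    -- If `w` misses some p in `x` and some s in `z`, then the chain {p, s} meets all three sets, as
    -- p also lies in `y`, but does not meet `w`.
    have hbase : x.1 ⊆ w.1 ∨ z.1 ⊆ w.1 := by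
      by_contra! h
      obtain ⟨⟨p, hp, hpw⟩, ⟨s, hs, hsw⟩⟩ := h.imp Finset.not_subset.1 Finset.not_subset.1
      obtain ⟨u, hu, huw⟩ := hK {p, s} (isChain_pair hr (rank_ne_of_depth_lt lxz hp hs))
        ⟨p, by simp, hp⟩ ⟨p, by simp, cxy.2.1 hp⟩ ⟨s, by simp, hs⟩
      rw [Finset.mem_insert, Finset.mem_singleton] at hu
      rcases hu with rfl | rfl
      exacts [hpw huw, hsw huw]
    rcases hbase with h | h
    · have hwy : w.1 ⊆ y.1 := by
        obtain ⟨p, hp⟩ := hx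
        intro u hu
        rcases hsub u hu with h' | h' | h'
        · exact cxy.2.1 h'
        · exact h'
        · exact absurd (w.2 _ (h hp) _ hu) (rank_ne_of_depth_lt lxz hp h')
      rcases eq_of_subset_of_subset_of_cov cxy h hwy with h | h
      exacts [Or.inl h, Or.inr (Or.inl h)]
    · refine Or.inr (Or.inr (Subtype.ext (Finset.Subset.antisymm (fun u hu => ?_) h)))
      obtain ⟨s, hs⟩ := hz
      rcases hsub u hu with h' | h' | h'
      · exact absurd (w.2 _ hu _ (h hs)) (rank_ne_of_depth_lt lxz h' hs)
      · exact absurd (w.2 _ hu _ (h hs)) (rank_ne_of_depth_lt lyz h' hs)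
      · exact h'
  rcases hyz with cyz | ⟨lyz, -⟩
  · have lxz : depth x < depth z := cyz.1 ▸ lxy
    have hbase : x.1 ⊆ w.1 ∨ y.1 ⊆ w.1 := by
      by_contra! h
      obtain ⟨⟨p, hp, hpw⟩, ⟨s, hs, hsw⟩⟩ := h.imp Finset.not_subset.1 Finset.not_subset.1
      obtain ⟨u, hu, huw⟩ := hK {p, s} (isChain_pair hr (rank_ne_of_depth_lt lxy hp hs))
        ⟨p, by simp, hp⟩ ⟨s, by simp, hs⟩ ⟨s, by simp, cyz.2.1 hs⟩
      rw [Finset.mem_insert, Finset.mem_singleton] at hu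
      rcases hu with rfl | rfl
      exacts [hpw huw, hsw huw]
    rcases hbase with h | h
    · refine Or.inl (Subtype.ext (Finset.Subset.antisymm (fun u hu => ?_) h))
      obtain ⟨s, hs⟩ := hx
      rcases hsub u hu with h' | h' | h'
      · exact h'
      · exact absurd (w.2 _ (h hs) _ hu) (rank_ne_of_depth_lt lxy hs h')
      · exact absurd (w.2 _ (h hs) _ hu) (rank_ne_of_depth_lt lxz hs h')
    · have hwz : w.1 ⊆ z.1 := by
        obtain ⟨p, hp⟩ := hy
        intro u hu
        rcases hsub u hu with h' | h' | h'
        · exact absurd (w.2 _ hu _ (h hp)) (rank_ne_of_depth_lt lxy h' hp)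
        · exact cyz.2.1 h'
        · exact h'
      exact Or.inr (eq_of_subset_of_subset_of_cov cyz h hwz)
  · have lxz := lxy.trans lyz
    have hbase : x.1 ⊆ w.1 ∨ y.1 ⊆ w.1 ∨ z.1 ⊆ w.1 := by
      by_contra! h
      obtain ⟨h1, h2, h3⟩ := h
      obtain ⟨p, hp, hpw⟩ := Finset.not_subset.1 h1
      obtain ⟨q, hq, hqw⟩ := Finset.not_subset.1 h2
      obtain ⟨s, hs, hsw⟩ := Finset.not_subset.1 h3
      obtain ⟨u, hu, huw⟩ := hK {p, q, s} (isChain_triple hr (rank_ne_of_depth_lt lxy hp hq)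
        (rank_ne_of_depth_lt lyz hq hs) (rank_ne_of_depth_lt lxz hp hs))
        ⟨p, by simp, hp⟩ ⟨q, by simp, hq⟩ ⟨s, by simp, hs⟩
      rw [Finset.mem_insert, Finset.mem_insert, Finset.mem_singleton] at hu
      rcases hu with rfl | rfl | rfl
      exacts [hpw huw, hqw huw, hsw huw]
    rcases hbase with h | h | h
    · refine Or.inl (Subtype.ext (Finset.Subset.antisymm (fun u hu => ?_) h))
      obtain ⟨s, hs⟩ := hx
      rcases hsub u hu with h' | h' | h'
      · exact h'
      · exact absurd (w.2 _ (h hs) _ hu) (rank_ne_of_depth_lt lxy hs h')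
      · exact absurd (w.2 _ (h hs) _ hu) (rank_ne_of_depth_lt lxz hs h')
    · refine Or.inr (Or.inl (Subtype.ext (Finset.Subset.antisymm (fun u hu => ?_) h)))
      obtain ⟨s, hs⟩ := hy
      rcases hsub u hu with h' | h' | h'
      · exact absurd (w.2 _ hu _ (h hs)) (rank_ne_of_depth_lt lxy h' hs)
      · exact h'
      · exact absurd (w.2 _ (h hs) _ hu) (rank_ne_of_depth_lt lyz hs h')
    · refine Or.inr (Or.inr (Subtype.ext (Finset.Subset.antisymm (fun u hu => ?_) h)))
      obtain ⟨s, hs⟩ := hz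
      rcases hsub u hu with h' | h' | h'
      · exact absurd (w.2 _ hu _ (h hs)) (rank_ne_of_depth_lt lxz h' hs)
      · exact absurd (w.2 _ hu _ (h hs)) (rank_ne_of_depth_lt lyz h' hs)
      · exact h'

end LevelSet

/-- A functional on the order polytope whose maximal vertices are the order ideals between `I` and
`K` that are unions of connected components on `J \ I` and on `K \ J`. -/
theorem exists_order_functional [Fintype P] {W : Type*} {g : W → Finset P}
    (hg : ∀ w, IsLowerSet (g w : Set P)) (I J K : Finset P) :
    ∃ (l : (P → ℝ) →ₗ[ℝ] ℝ) (M : ℝ), (∀ w, l (indicatorVector (g w)) ≤ M) ∧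
      ∀ w, l (indicatorVector (g w)) = M ↔
        (∀ p, (p ∈ I → p ∈ g w) ∧ (p ∈ g w → p ∈ I ∨ p ∈ K)) ∧
        ∀ p q, p < q → (p ∈ J ∧ p ∉ I ∧ q ∈ J ∧ q ∉ I) ∨ (p ∈ K ∧ p ∉ J ∧ q ∈ K ∧ q ∉ J) →
          (p ∈ g w ↔ q ∈ g w) := by
  let good : P × P → Prop := fun t => t.1 < t.2 ∧ ((t.1 ∈ J ∧ t.1 ∉ I ∧ t.2 ∈ J ∧ t.2 ∉ I) ∨
    (t.1 ∈ K ∧ t.1 ∉ J ∧ t.2 ∈ K ∧ t.2 ∉ J))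
  let l : P ⊕ P × P → (P → ℝ) →ₗ[ℝ] ℝ := Sum.elim
    (fun p => if p ∈ I then LinearMap.proj p else if p ∈ K then 0 else -LinearMap.proj p)
    (fun t => if good t then
      (LinearMap.proj t.2 : (P → ℝ) →ₗ[ℝ] ℝ) - LinearMap.proj t.1 else 0)
  let m : P ⊕ P × P → ℝ := Sum.elim (fun p => if p ∈ I then 1 else 0) (fun _ => 0)
  obtain ⟨k, M, h1, h2⟩ := exists_functional_of_family
    (fun w : W => indicatorVector (g w)) l m (by
      rintro (p | t) w
      · by_cases h : p ∈ I <;> by_cases h' : p ∈ K <;> by_cases hw : p ∈ g w <;>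
          simp [l, m, h, h', indicatorVector, hw]
      · by_cases h : good t
        · have := (indicatorVector_mem_orderPolytope (hg w)).2 _ _ h.1.le
          simpa [l, m, h] using this
        · simp [l, m, h])
  refine ⟨k, M, h1, fun w => (h2 w).trans ⟨fun h => ⟨fun p => ?_, fun p q hpq hD => ?_⟩,
    fun h => ?_⟩⟩
  · have h3 := h (Sum.inl p)
    by_cases hI : p ∈ I <;> by_cases hK : p ∈ K <;> by_cases hw : p ∈ g w <;>
      simp [l, m, hI, hK, indicatorVector, hw] at h3 ⊢
  · have h3 := h (Sum.inr (p, q))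
    have hgood : good (p, q) := ⟨hpq, hD⟩
    by_cases hp : p ∈ g w <;> by_cases hq : q ∈ g w <;>
      simp [l, m, indicatorVector, hgood, hp, hq] at h3 ⊢
  · rintro (p | t)
    · have h3 := h.1 p
      by_cases hI : p ∈ I <;> by_cases hK : p ∈ K <;> by_cases hw : p ∈ g w <;>
        simp [l, m, hI, hK, indicatorVector, hw] at h3 ⊢
    · by_cases hgood : good t
      · have h3 := h.2 t.1 t.2 hgood.1 hgood.2
        by_cases hp : t.1 ∈ g w <;> by_cases hq : t.2 ∈ g w <;>
          simp [l, m, indicatorVector, hgood, hp, hq] at h3 ⊢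
      · simp [l, m, hgood]

/-- The set `E \ D` is connected in the comparability graph. -/
def IsConnectedDiff (D E : Finset P) : Prop :=
  ∀ G : Finset P, (∀ p q, p < q → p ∈ E → p ∉ D → q ∈ E → q ∉ D → (p ∈ G ↔ q ∈ G)) →
    ∀ p q, p ∈ E → p ∉ D → q ∈ E → q ∉ D → (p ∈ G ↔ q ∈ G)

/-- Since the two successive differences are connected, a maximal ideal contains or avoids each as a
whole. This leaves `g x`, `g y`, `g z` and the union of `g x` with `g z \ g y`; connectedness of `g
z \ g x` is what rules out the last. -/
theorem order_face_of_connected [Fintype P] {W : Type*} {g : W → Finset P}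
    (hg : ∀ w, IsLowerSet (g w : Set P)) (hinj : Function.Injective g) {x y z : W}
    (hxy : g x ⊂ g y) (hyz : g y ⊂ g z) (cxy : IsConnectedDiff (g x) (g y))
    (cyz : IsConnectedDiff (g y) (g z)) (cxz : IsConnectedDiff (g x) (g z)) :
    ∃ (l : (P → ℝ) →ₗ[ℝ] ℝ) (M : ℝ), (∀ w, l (indicatorVector (g w)) ≤ M) ∧
      ∀ w, l (indicatorVector (g w)) = M ↔ w = x ∨ w = y ∨ w = z := by
  obtain ⟨l, M, h1, h2⟩ := exists_order_functional hg (g x) (g y) (g z)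
  refine ⟨l, M, h1, fun w => (h2 w).trans ⟨?_, ?_⟩⟩
  swap
  · have a1 := @(Finset.ssubset_iff_subset_ne.1 hxy).1
    have a2 := @(Finset.ssubset_iff_subset_ne.1 hyz).1
    rintro (rfl | rfl | rfl)
    · exact ⟨fun p => ⟨id, Or.inl⟩, fun p q _ h => by grind⟩
    · exact ⟨fun p => ⟨@a1 p, fun h => Or.inr (a2 h)⟩, fun p q _ h => by grind⟩
    · exact ⟨fun p => ⟨fun h => a2 (a1 h), Or.inr⟩, fun p q _ h => by grind⟩
  rintro ⟨hw, hpq⟩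
  obtain ⟨hxy', d, hdy, hdx⟩ := 
    (⟨hxy.1, by simpa [Finset.not_subset] using hxy.2⟩ : g x ⊆ g y ∧ ∃ d ∈ g y, d ∉ g x)
  obtain ⟨hyz', e, hez, hey⟩ :=
    (⟨hyz.1, by simpa [Finset.not_subset] using hyz.2⟩ : g y ⊆ g z ∧ ∃ d ∈ g z, d ∉ g y)
  have hD := cxy (g w) fun p q h a b c f => hpq p q h (Or.inl ⟨a, b, c, f⟩)
  have hE := cyz (g w) fun p q h a b c f => hpq p q h (Or.inr ⟨a, b, c, f⟩)
  by_cases hd : d ∈ g w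
  · by_cases he : e ∈ g w
    · refine Or.inr (Or.inr (hinj (Finset.ext fun p => ?_)))
      have := hD d p hdy hdx
      have := hE e p hez hey
      have := hw p
      have := @hxy' p
      have := @hyz' p
      grind
    · refine Or.inr (Or.inl (hinj (Finset.ext fun p => ?_)))
      have := hD d p hdy hdx
      have := hE e p hez hey
      have := hw p
      have := @hxy' p
      have := @hyz' p
      grind
  · by_cases he : e ∈ g w
    · exfalso
      -- As `g w` and `g y` are both lower sets, no comparability joins the two differences, so `g
      -- w` would separate `g z \ g x`.
      have hcon := cxz (g w) (fun p q hlt hp hp' hq hq' => by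
        have h3 : q ∈ g w → p ∈ g w := fun h => hg w hlt.le h
        have h4 : q ∈ g y → p ∈ g y := fun h => hg y hlt.le h
        have := hD d p hdy hdx
        have := hD d q hdy hdx
        have := hE e p hez hey
        have := hE e q hez hey
        grind) d e (hyz' hdy) hdx hez fun h => hey (hxy' h)
      exact hd (hcon.2 he)
    · refine Or.inl (hinj (Finset.ext fun p => ?_))
      have := hD d p hdy hdx
      have := hE e p hez hey
      have := hw p
      have := @hxy' p
      have := @hyz' p
      grind

namespace LevelSet
variable [Fintype P] {r : P → ℕ}

theorem ideal_ssubset_of_orderAdj {P : Type*} [Fintype P] {r : P → ℕ} {A B : LevelSet r} (h : OrderAdj A B) : ideal A ⊂ ideal B := by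
  have hsub : ideal A ⊆ ideal B := by
    intro p hp
    rcases h with h | h
    · rcases mem_ideal.1 hp with hp | hp
      · exact mem_ideal.2 (Or.inl (h.2.1 hp))
      · exact mem_ideal.2 (Or.inr (h.1 ▸ hp))
    · exact mem_ideal.2 (Or.inr ((le_depth_of_mem_ideal hp).trans_lt h.1))
  refine Finset.ssubset_iff_subset_ne.2 ⟨hsub, fun he => ?_⟩
  have := weight_lt_of_levelAdj h
  rw [ideal_injective he] at this
  exact lt_irrefl _ this

/-- Elements of different ranks are comparable, so a difference with two distinct elements is
connected once it meets two ranks. It fails to be connected only as an antichain of size at least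
two, which adjacency excludes. -/
theorem isConnectedDiff_of_orderAdj (hr : ∀ p q, p < q ↔ r p < r q)
    (hs : ∀ p k, k < r p → ∃ q, r q = k) {A B : LevelSet r} (h : OrderAdj A B) :
    IsConnectedDiff (ideal A) (ideal B) := by
  intro G hG
  have hne : ∀ p q, p ∈ ideal B → p ∉ ideal A → q ∈ ideal B → q ∉ ideal A → r p ≠ r q →
      (p ∈ G ↔ q ∈ G) := by
    intro p q hp hp' hq hq' hpq
    rcases lt_or_gt_of_ne hpq with h | h
    · exact hG p q ((hr p q).2 h) hp hp' hq hq'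
    · exact (hG q p ((hr q p).2 h) hq hq' hp hp').symm
  intro p q hp hp' hq hq'
  by_cases hpq : r p = r q
  swap
  · exact hne p q hp hp' hq hq' hpq
  by_cases heq : p = q
  · rw [heq]
  suffices hu : ∃ u, u ∈ ideal B ∧ u ∉ ideal A ∧ r u ≠ r p by
    obtain ⟨u, hu, hu', hup⟩ := hu
    exact (hne p u hp hp' hu hu' hup.symm).trans
      (hne u q hu hu' hq hq' (fun h => hup (h.trans hpq.symm)))
  have hpB := le_depth_of_mem_ideal hp
  rcases h with h | ⟨hlt, h⟩
  · exfalso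
    have key : ∀ u, u ∈ ideal B → u ∉ ideal A → u ∈ B.1 \ A.1 := by
      intro u hu hu'
      refine Finset.mem_sdiff.2 ⟨(mem_ideal.1 hu).resolve_right fun h' =>
        hu' (mem_ideal.2 (Or.inr (h.1 ▸ h'))), fun h' => hu' (mem_ideal.2 (Or.inl h'))⟩
    have hc : (B.1 \ A.1).card ≤ 1 := by
      rw [Finset.card_sdiff_of_subset h.2.1, h.2.2]
      omega
    exact heq (Finset.card_le_one.1 hc p (key p hp hp') q (key q hq hq'))
  obtain ⟨v, hv⟩ := nonempty_of_depth_pos (Nat.zero_lt_of_lt hlt)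
  have hvd := depth_eq hv
  by_cases hpv : r p = r v
  · have hpB' : p ∈ B.1 := mem_of_mem_ideal hp (by omega)
    have hqB' : q ∈ B.1 := mem_of_mem_ideal hq (by omega)
    have hAb := h.resolve_left (not_not.2 (Finset.one_lt_card.2 ⟨p, hpB', q, hqB', heq⟩))
    -- Either `A` omits some element of the level just below `B`, or that entire level lies outside
    -- `ideal A`; both give an element of another rank.
    by_cases hA : depth A + 1 = depth B
    · have : ∃ u, r u + 1 = depth A ∧ u ∉ A.1 := by
        by_contra! hcon
        refine hAb (Subtype.ext (Finset.ext fun u => ?_))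
        rw [mem_fullBelow]
        refine ⟨fun hu => ?_, fun hu => hcon u (by omega)⟩
        rw [← hA, depth_eq hu]
      obtain ⟨u, hu, huA⟩ := this
      refine ⟨u, mem_ideal.2 (Or.inr (by omega)), fun h' => huA (mem_of_mem_ideal h' hu), by omega⟩
    · obtain ⟨u, hu⟩ := hs v (r v - 1) (by omega)
      refine ⟨u, mem_ideal.2 (Or.inr (by omega)), fun h' => ?_, by omega⟩
      have := le_depth_of_mem_ideal h'
      omega
  · refine ⟨v, mem_ideal.2 (Or.inl hv), fun h' => ?_, Ne.symm hpv⟩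
    have := le_depth_of_mem_ideal h'
    omega

theorem order_face (hr : ∀ p q, p < q ↔ r p < r q) (hs : ∀ p k, k < r p → ∃ q, r q = k)
    {x y z : LevelSet r} (hxy : OrderAdj x y) (hyz : OrderAdj y z) (hxz : OrderAdj x z) :
    ∃ (l : (P → ℝ) →ₗ[ℝ] ℝ) (M : ℝ), (∀ w : LevelSet r, l (indicatorVector (ideal w)) ≤ M) ∧
      ∀ w : LevelSet r, l (indicatorVector (ideal w)) = M ↔ w = x ∨ w = y ∨ w = z :=
  order_face_of_connected (isLowerSet_ideal hr) ideal_injective (ideal_ssubset_of_orderAdj hxy)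
    (ideal_ssubset_of_orderAdj hyz) (isConnectedDiff_of_orderAdj hr hs hxy)
    (isConnectedDiff_of_orderAdj hr hs hyz) (isConnectedDiff_of_orderAdj hr hs hxz)

end LevelSet
end Faces

/-! ### Comparing the two triangle counts -/

section Counting
open Classical

namespace LevelSet
variable {P : Type*} {r : P → ℕ}

/-- The number of big level sets on level `i`. -/
noncomputable def bigCount [Fintype P] (r : P → ℕ) (i : ℕ) : ℕ :=
  (Finset.univ.filter fun A : LevelSet r => Big A ∧ depth A = i + 1).card

theorem chainAdj_bot_iff {A : LevelSet r} : ChainAdj (bot r) A ↔ A.1.card = 1 := by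
  constructor
  · rintro (h | h)
    · obtain ⟨p, hp⟩ := h.nonempty
      exact absurd hp (Finset.notMem_empty p)
    · have h1 := h.2.resolve_right (not_not.2 rfl)
      have h2 := (nonempty_of_depth_pos (Nat.zero_lt_of_lt h.1)).card_pos
      unfold Big at h1
      omega
  · intro h
    have hne : A.1.Nonempty := Finset.card_pos.1 (by omega)
    obtain ⟨p, hp⟩ := hne
    refine Or.inr ⟨?_, Or.inl ?_⟩
    · rw [depth_of_eq_empty rfl, depth_eq hp]
      exact Nat.succ_pos _
    · unfold Big
      omega

theorem not_chainAdj_bot {A : LevelSet r} : ¬ ChainAdj A (bot r) := by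
  rintro (h | h)
  · exact absurd h.2.2 (by simp [bot])
  · have := h.1
    rw [depth_of_eq_empty (A := bot r) rfl] at this
    exact Nat.not_lt_zero _ this

/-- The neighbours of ∅ are exactly the singletons, and all its edges go upward. -/
theorem exceptionalDegree_chain [Fintype P] (k : ℕ) :
    exceptionalDegree (depth (r := r)) Cov Big (fun _ => bot r) k =
      ∑ y : LevelSet r, if depth y < k ∧ y.1.card = 1 then 1 else 0 := by
  refine Finset.sum_congr rfl fun y _ => ?_
  rw [ite_and]
  refine if_congr Iff.rfl ?_ rfl
  have : ∀ x : LevelSet r, (if LevelAdj depth Cov Big (fun _ => bot r) x y then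
      ((if x = bot r then 1 else 0) + (if y = bot r then 1 else 0) : ℤ) else 0) =
      if x = bot r then (if y.1.card = 1 then 1 else 0) else 0 := by
    intro x
    by_cases hx : x = bot r
    · subst hx
      have h1 : ¬ (y.1.card = 1 ∧ y = bot r) := by
        rintro ⟨h, rfl⟩
        simp [bot] at h
      rw [if_congr chainAdj_bot_iff rfl rfl]
      by_cases h2 : y.1.card = 1
      · have h3 : y ≠ bot r := fun h => h1 ⟨h2, h⟩
        simp [h2, h3]
      · simp [h2]
    · by_cases hy : y = bot r
      · subst hy
        rw [if_neg not_chainAdj_bot, if_neg hx]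
      · simp [hx, hy]
  refine Eq.trans (Finset.sum_congr rfl fun x _ => ?_)
    (Finset.sum_ite_eq' Finset.univ (bot r) fun _ => if y.1.card = 1 then 1 else 0) |>.trans
      (if_pos (Finset.mem_univ _))
  convert this x

/-- The singleton level set. -/
def single (r : P → ℕ) (p : P) : LevelSet r :=
  ⟨{p}, fun q hq q' hq' => by
    rw [Finset.mem_singleton.1 hq, Finset.mem_singleton.1 hq']⟩

variable [Fintype P]

theorem card_single_fullBelow {k : ℕ} :
    (Finset.univ.filter fun A : LevelSet r => depth A + 1 = k ∧ A.1.card = 1).card =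
      (fullBelow r k).1.card := by
  refine (Finset.card_bij (fun p _ => single r p) (fun p hp => ?_) (fun p _ q _ h => ?_)
    fun A hA => ?_).symm
  · rw [mem_fullBelow] at hp
    refine Finset.mem_filter.2 ⟨Finset.mem_univ _, ?_, rfl⟩
    rw [depth_eq (Finset.mem_singleton_self p : p ∈ (single r p).1)]
    exact hp
  · exact Finset.singleton_injective (congrArg Subtype.val h)
  · obtain ⟨-, h1, h2⟩ := Finset.mem_filter.1 hA
    obtain ⟨p, hp⟩ := Finset.card_eq_one.1 h2
    refine ⟨p, ?_, Subtype.ext hp.symm⟩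
    rw [mem_fullBelow]
    rw [depth_eq (by rw [hp]; exact Finset.mem_singleton_self p : p ∈ A.1)] at h1
    exact h1

theorem card_cov {B : LevelSet r} :
    (Finset.univ.filter fun A : LevelSet r => Cov A B).card = if Big B then B.1.card else 0 := by
  by_cases hB : Big B
  · rw [if_pos hB]
    refine (Finset.card_bij (fun p _ => (⟨B.1.erase p, fun q hq q' hq' =>
      B.2 q (Finset.mem_of_mem_erase hq) q' (Finset.mem_of_mem_erase hq')⟩ : LevelSet r))
      (fun p hp => ?_) (fun p hp q hq h => ?_) fun A hA => ?_).symm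
    · refine Finset.mem_filter.2 ⟨Finset.mem_univ _, ?_, Finset.erase_subset _ _, ?_⟩
      · obtain ⟨q, hq⟩ : (B.1.erase p).Nonempty := by
          rw [← Finset.card_pos, Finset.card_erase_of_mem hp]
          unfold Big at hB
          omega
        rw [depth_eq hq, depth_eq (Finset.mem_of_mem_erase hq)]
      · rw [Finset.card_erase_of_mem hp]
        unfold Big at hB
        omega
    · have h' : B.1.erase p = B.1.erase q := congrArg Subtype.val h
      by_contra hne
      have : p ∈ B.1.erase q := Finset.mem_erase.2 ⟨hne, hp⟩
      rw [← h'] at this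
      exact Finset.notMem_erase _ _ this
    · obtain ⟨-, h1, h2, h3⟩ := Finset.mem_filter.1 hA
      have hc : (B.1 \ A.1).card = 1 := by
        rw [Finset.card_sdiff_of_subset h2]
        omega
      obtain ⟨p, hp⟩ := Finset.card_eq_one.1 hc
      have hp' : p ∈ B.1 \ A.1 := hp ▸ Finset.mem_singleton_self p
      refine ⟨p, (Finset.mem_sdiff.1 hp').1, Subtype.ext ?_⟩
      change B.1.erase p = A.1
      rw [Finset.erase_eq, ← hp, Finset.sdiff_sdiff_eq_self h2]
  · rw [if_neg hB, Finset.card_eq_zero, Finset.filter_eq_empty_iff]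
    exact fun A _ h => hB h.big

/-- Let T be the full level below `z`, when there is one. All edges of T below the level of `z` come
from below, and `sum_levelAdj_left` counts them: |T| covers if T is big, plus all sets of smaller
depth, minus 1 if T is big. The sets of smaller depth are ∅, singletons and big sets; together with
the |T| singletons inside T, the singletons account for the degree of ∅, and the big sets are the
surplus. -/
theorem exceptionalDegree_order (hs : ∀ p k, k < r p → ∃ q, r q = k) {z : LevelSet r}
    (hz : Big z) :
    exceptionalDegree (depth (r := r)) Cov Big (fullBelow r) (depth z) =
      exceptionalDegree (depth (r := r)) Cov Big (fun _ => bot r) (depth z) +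
        ((Finset.univ.filter fun v : LevelSet r => Big v ∧ depth v + 1 < depth z).card : ℤ) := by
  obtain ⟨p, hp⟩ := hz.nonempty
  have hk := depth_eq hp
  generalize depth z = k at hk
  rw [exceptionalDegree_chain, Finset.sum_boole]
  rcases Nat.eq_zero_or_pos (r p) with h0 | h0
  · have hk1 : k = 1 := by omega
    subst hk1
    have h1 : exceptionalDegree (depth (r := r)) Cov Big (fullBelow r) 1 = 0 := by
      refine Finset.sum_eq_zero fun y _ => ?_
      by_cases hy : depth y < 1
      · rw [if_pos hy]
        refine Finset.sum_eq_zero fun x _ => if_neg ?_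
        rintro (h | h)
        · have := h.big.depth_pos
          omega
        · have := h.1
          omega
      · rw [if_neg hy]
    have h2 : (Finset.univ.filter fun y : LevelSet r => depth y < 1 ∧ y.1.card = 1) = ∅ := by
      refine Finset.filter_eq_empty_iff.2 fun y _ h => ?_
      obtain ⟨q, hq⟩ := Finset.card_pos.1 (by omega : 0 < y.1.card)
      have := depth_eq hq
      omega
    have h3 : (Finset.univ.filter fun v : LevelSet r => Big v ∧ depth v + 1 < 1) = ∅ :=
      Finset.filter_eq_empty_iff.2 fun y _ h => by omega
    rw [h1, h2, h3]
    simp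
  obtain ⟨q, hq⟩ := hs p (r p - 1) (by omega)
  have hqt : q ∈ (fullBelow r k).1 := mem_fullBelow.2 (by omega)
  have ht : depth (fullBelow r k) + 1 = k := by
    rw [depth_eq hqt]
    omega
  have hbk : ∀ y : LevelSet r, Big y → depth (fullBelow r (depth y)) < depth y :=
    fun y hy => depth_fullBelow_lt hy.depth_pos
  -- T is the largest set on the highest level below depth k, so in the degree sum only the terms
  -- ending at T survive.
  have hno : ∀ y : LevelSet r, depth y < k → ¬ OrderAdj (fullBelow r k) y := by
    rintro y hy (h | h)
    · have : y.1 ⊆ (fullBelow r k).1 := fun u hu => by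
        have := h.1
        rw [depth_eq hu] at this
        rw [mem_fullBelow]
        omega
      have := Finset.card_le_card this
      have := h.2.2
      omega
    · have := h.1
      omega
  have h1 : exceptionalDegree (depth (r := r)) Cov Big (fullBelow r) k =
      ∑ x : LevelSet r, if OrderAdj x (fullBelow r k) then (1 : ℤ) else 0 := by
    have h2 : ∀ y : LevelSet r, (if depth y < k then ∑ x, if OrderAdj x y then
        ((if x = fullBelow r k then 1 else 0) + (if y = fullBelow r k then 1 else 0) : ℤ)
          else 0 else 0) = if y = fullBelow r k then
            ∑ x : LevelSet r, if OrderAdj x (fullBelow r k) then (1 : ℤ) else 0 else 0 := by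
      intro y
      by_cases hy : depth y < k
      · have h3 : ∀ x : LevelSet r, (if OrderAdj x y then
            ((if x = fullBelow r k then 1 else 0) + (if y = fullBelow r k then 1 else 0) : ℤ)
            else 0) = if OrderAdj x y then (if y = fullBelow r k then 1 else 0) else 0 := by
          intro x
          by_cases hxy : OrderAdj x y
          · have : x ≠ fullBelow r k := by
              rintro rfl
              exact hno y hy hxy
            simp only [if_pos hxy, if_neg this, zero_add]
          · simp only [if_neg hxy]
        rw [if_pos hy, Finset.sum_congr rfl fun x _ => h3 x]
        by_cases hyt : y = fullBelow r k
        · simp only [if_pos hyt]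
          rw [hyt]
        · simp only [if_neg hyt, ite_self, Finset.sum_const_zero]
      · rw [if_neg hy, if_neg]
        rintro rfl
        omega
    refine Eq.trans (Finset.sum_congr rfl fun y _ => ?_)
      (Finset.sum_ite_eq' Finset.univ (fullBelow r k) fun _ =>
        ∑ x : LevelSet r, if OrderAdj x (fullBelow r k) then (1 : ℤ) else 0) |>.trans
        (if_pos (Finset.mem_univ _))
    convert h2 y
  rw [h1, sum_levelAdj_left depth Cov Big (fullBelow r) (fun x y h => h.1) hbk, Finset.sum_boole,
    Finset.sum_boole, card_cov]
  have h2 : (Finset.univ.filter fun x : LevelSet r => depth x < depth (fullBelow r k)).card =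
      1 + (Finset.univ.filter fun x : LevelSet r =>
        depth x < depth (fullBelow r k) ∧ x.1.card = 1).card +
      (Finset.univ.filter fun v : LevelSet r => Big v ∧ depth v + 1 < k).card := by
    have h3 : (Finset.univ.filter fun x : LevelSet r => depth x < depth (fullBelow r k)) =
        insert (bot r) ((Finset.univ.filter fun x : LevelSet r =>
          depth x < depth (fullBelow r k) ∧ x.1.card = 1) ∪
          Finset.univ.filter fun v : LevelSet r => Big v ∧ depth v + 1 < k) := by
      ext x
      simp only [Finset.mem_filter, Finset.mem_univ, true_and, Finset.mem_insert,
        Finset.mem_union]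
      constructor
      · intro h
        rcases Nat.lt_trichotomy x.1.card 1 with h' | h' | h'
        · exact Or.inl (Subtype.ext (Finset.card_eq_zero.1 (by omega)))
        · exact Or.inr (Or.inl ⟨h, h'⟩)
        · exact Or.inr (Or.inr ⟨h', by omega⟩)
      · rintro (rfl | h | h)
        · rw [depth_of_eq_empty (A := bot r) rfl, depth_eq hqt]
          omega
        · exact h.1
        · omega
    rw [h3, Finset.card_insert_of_notMem, Finset.card_union_of_disjoint]
    · omega
    · rw [Finset.disjoint_filter]
      intro x _ h h'
      have := h'.1
      unfold Big at this
      omega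
    · rw [Finset.mem_union, Finset.mem_filter, Finset.mem_filter]
      rintro (h | h)
      · exact absurd h.2.2 (by simp [bot])
      · obtain ⟨u, hu⟩ := h.2.1.nonempty
        exact Finset.notMem_empty u hu
  have h4 : (Finset.univ.filter fun y : LevelSet r => depth y < k ∧ y.1.card = 1).card =
      (Finset.univ.filter fun x : LevelSet r =>
        depth x < depth (fullBelow r k) ∧ x.1.card = 1).card + (fullBelow r k).1.card := by
    rw [← card_single_fullBelow (r := r) (k := k), ← Finset.card_union_of_disjoint]
    · congr 1
      ext x
      simp only [Finset.mem_filter, Finset.mem_univ, true_and, Finset.mem_union]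
      omega
    · rw [Finset.disjoint_filter]
      intro x _ h h'
      omega
  -- If T is not big it has exactly one element, and that singleton replaces the missing
  -- contribution of ∅.
  have h5 : 0 < (fullBelow r k).1.card := Finset.card_pos.2 ⟨q, hqt⟩
  rw [h2, h4]
  by_cases hbig : Big (fullBelow r k)
  · rw [if_pos hbig, if_pos hbig]
    push_cast
    ring
  · rw [if_neg hbig, if_neg hbig]
    have : (fullBelow r k).1.card = 1 := by
      unfold Big at hbig
      omega
    rw [this]
    push_cast
    ring

theorem ncard_chain_triangles (hs : ∀ p k, k < r p → ∃ q, r q = k) :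
    {t : LevelSet r × LevelSet r × LevelSet r | ChainAdj t.1 t.2.1 ∧ ChainAdj t.2.1 t.2.2 ∧
        ChainAdj t.1 t.2.2}.ncard =
      {t : LevelSet r × LevelSet r × LevelSet r | OrderAdj t.1 t.2.1 ∧ OrderAdj t.2.1 t.2.2 ∧
        OrderAdj t.1 t.2.2}.ncard +
      ∑ z : LevelSet r with Big z,
        (Finset.univ.filter fun v : LevelSet r => Big v ∧ depth v + 1 < depth z).card := by
  have hC := ncard_levelAdj_triangles (W := LevelSet r) depth Cov Big (fun _ => bot r)
    (fun x y h => h.1) (fun x y h => h.big) (fun x y z h h' => h.not_cov_trans h')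
    (fun y hy => by rw [depth_of_eq_empty (A := bot r) rfl]; exact hy.depth_pos)
  have hO := ncard_levelAdj_triangles (W := LevelSet r) depth Cov Big (fullBelow r)
    (fun x y h => h.1) (fun x y h => h.big) (fun x y z h h' => h.not_cov_trans h')
    (fun y hy => depth_fullBelow_lt hy.depth_pos)
  have hsum : (∑ z : LevelSet r, if Big z then
      exceptionalDegree depth Cov Big (fullBelow r) (depth z) else 0) =
      (∑ z : LevelSet r, if Big z then
        exceptionalDegree depth Cov Big (fun _ => bot r) (depth z) else 0) +
      ((∑ z : LevelSet r with Big z, (Finset.univ.filter fun v : LevelSet r =>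
        Big v ∧ depth v + 1 < depth z).card : ℕ) : ℤ) := by
    rw [Finset.sum_filter, Nat.cast_sum, ← Finset.sum_add_distrib]
    refine Finset.sum_congr rfl fun z _ => ?_
    by_cases hz : Big z
    · rw [if_pos hz, if_pos hz, if_pos hz, exceptionalDegree_order hs hz]
    · simp [hz]
  have : ∀ a b c d e g : ℤ, a = c - d → b = c - e → e = d + g → a = b + g := by
    intros; linarith
  exact_mod_cast this _ _ _ _ _ _ hC hO hsum

/-- Put `z` on rank s and `v` on rank s - t. Depth is rank plus one, so `depth v + 1 < depth z` says
t ≥ 2, and positivity of `depth v` says t ≤ s. -/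
theorem sum_bigCount {n : ℕ} (hn : ∀ p, r p ≤ n) :
    (∑ z : LevelSet r with Big z,
        (Finset.univ.filter fun v : LevelSet r => Big v ∧ depth v + 1 < depth z).card) =
      ∑ s ∈ Finset.Icc 2 n, ∑ t ∈ Finset.Icc 2 s, bigCount r s * bigCount r (s - t) := by
  have h1 : (∑ z : LevelSet r with Big z,
        (Finset.univ.filter fun v : LevelSet r => Big v ∧ depth v + 1 < depth z).card) =
      ∑ z : LevelSet r with Big z ∧ 2 < depth z,
        (Finset.univ.filter fun v : LevelSet r => Big v ∧ depth v + 1 < depth z).card := by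
    refine (Finset.sum_subset (fun z hz => ?_) fun z hz hz' => ?_).symm
    · rw [Finset.mem_filter] at hz ⊢
      exact ⟨hz.1, hz.2.1⟩
    · rw [Finset.card_eq_zero, Finset.filter_eq_empty_iff]
      intro v _ hv
      have := hv.1.depth_pos
      refine hz' (Finset.mem_filter.2 ⟨Finset.mem_univ _, (Finset.mem_filter.1 hz).2, ?_⟩)
      omega
  rw [h1, ← Finset.sum_fiberwise_of_maps_to (g := fun z => depth z - 1) (t := Finset.Icc 2 n)]
  · refine Finset.sum_congr rfl fun s hs => ?_
    rw [Finset.mem_Icc] at hs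
    rw [← Finset.mul_sum]
    have h2 : (Finset.univ.filter fun v : LevelSet r => Big v ∧ depth v < s).card =
        ∑ t ∈ Finset.Icc 2 s, bigCount r (s - t) := by
      rw [Finset.card_eq_sum_card_fiberwise (f := fun v => s + 1 - depth v)
        (t := Finset.Icc 2 s)]
      · refine Finset.sum_congr rfl fun t ht => ?_
        rw [Finset.mem_Icc] at ht
        rw [Finset.filter_filter, bigCount]
        congr 1
        ext v
        simp only [Finset.mem_filter, Finset.mem_univ, true_and, and_assoc]
        refine and_congr_right fun hv => ?_
        have := hv.depth_pos
        omega
      · intro v hv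
        have hv' := (Finset.mem_filter.1 hv).2
        have := hv'.1.depth_pos
        refine Finset.mem_coe.2 (Finset.mem_Icc.2 ⟨?_, ?_⟩) <;> dsimp only <;> omega
    rw [← h2, Finset.filter_filter]
    have h3 : (Finset.univ.filter fun z : LevelSet r =>
        (Big z ∧ 2 < depth z) ∧ depth z - 1 = s) =
        Finset.univ.filter fun z : LevelSet r => Big z ∧ depth z = s + 1 := by
      ext z
      simp only [Finset.mem_filter, Finset.mem_univ, true_and, and_assoc]
      refine and_congr_right fun hz => ?_
      omega
    rw [h3, Finset.sum_congr rfl (g := fun _ =>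
      (Finset.univ.filter fun v : LevelSet r => Big v ∧ depth v < s).card), Finset.sum_const,
      smul_eq_mul, bigCount]
    intro z hz
    rw [(Finset.mem_filter.1 hz).2.2]
    congr 1
    ext v
    simp only [Finset.mem_filter, Finset.mem_univ, true_and]
    exact and_congr_right fun _ => by omega
  · intro z hz
    obtain ⟨-, hz1, hz2⟩ := Finset.mem_filter.1 hz
    obtain ⟨p, hp⟩ := hz1.nonempty
    have := depth_eq hp
    have := hn p
    rw [Finset.mem_Icc]
    omega

theorem bigCount_eq (i : ℕ) :
    bigCount r i = ∑ m ∈ Finset.Icc 2 {p | r p = i}.ncard, {p | r p = i}.ncard.choose m := by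
  have ha : {p | r p = i}.ncard = (Finset.univ.filter fun p => r p = i).card := by
    rw [← Set.ncard_coe_finset]
    congr 1
    ext p
    simp
  rw [ha]
  generalize hS : (Finset.univ.filter fun p => r p = i) = S
  have hSm : ∀ p, p ∈ S ↔ r p = i := fun p => by rw [← hS]; simp
  have h1 : bigCount r i = (S.powerset.filter fun A => 1 < A.card).card := by
    refine Finset.card_bij (fun A _ => A.1) (fun A hA => ?_) (fun A _ B _ h => Subtype.ext h)
      fun A hA => ?_
    · obtain ⟨-, h1, h2⟩ := Finset.mem_filter.1 hA
      refine Finset.mem_filter.2 ⟨Finset.mem_powerset.2 fun p hp => ?_, h1⟩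
      rw [depth_eq hp] at h2
      rw [hSm]
      omega
    · obtain ⟨h1, h2⟩ := Finset.mem_filter.1 hA
      have h3 : ∀ p ∈ A, r p = i := fun p hp => (hSm p).1 (Finset.mem_powerset.1 h1 hp)
      have hA' : IsHomogeneous r A := fun p hp q hq => by rw [h3 p hp, h3 q hq]
      refine ⟨⟨A, hA'⟩, Finset.mem_filter.2 ⟨Finset.mem_univ _, h2, ?_⟩, rfl⟩
      obtain ⟨p, hp⟩ := Finset.card_pos.1 (Nat.zero_lt_of_lt h2)
      rw [depth_eq (A := ⟨A, hA'⟩) hp, h3 p hp]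
  rw [h1, Finset.card_eq_sum_card_fiberwise (f := Finset.card) (t := Finset.Icc 2 S.card)]
  · refine Finset.sum_congr rfl fun m hm => ?_
    rw [← Finset.card_powersetCard]
    congr 1
    ext A
    rw [Finset.mem_Icc] at hm
    simp only [Finset.mem_filter, Finset.mem_powerset, Finset.mem_powersetCard]
    constructor
    · rintro ⟨⟨h1, -⟩, h2⟩
      exact ⟨h1, h2⟩
    · rintro ⟨h1, h2⟩
      exact ⟨⟨h1, by omega⟩, h2⟩
  · intro A hA
    obtain ⟨h1, h2⟩ := Finset.mem_filter.1 hA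
    rw [Finset.mem_coe, Finset.mem_Icc]
    exact ⟨h2, Finset.card_le_card (Finset.mem_powerset.1 h1)⟩

end LevelSet
end Counting

/-! ### The rank function of a maximal ranked poset -/

section Heights
variable {P : Type*} [PartialOrder P]

theorem height_le_of_isGradedOfRank [Finite P] {n : ℕ} (h : IsGradedOfRank P n) (p : P) :
    Order.height p ≤ n := by
  refine Order.height_le fun s _ => ?_
  have hch : IsChain (· ≤ ·) (Set.range s) := s.strictMono.monotone.isChain_range
  -- Any chain extends to a maximal one, whose size is prescribed by gradedness.
  obtain ⟨M, hM, hsM⟩ := hch.exists_maxChain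
  have h1 := Set.ncard_le_ncard hsM (Set.toFinite M)
  rw [h M hM, ← Set.image_univ, Set.InjOn.ncard_image s.strictMono.injective.injOn,
    Set.ncard_univ, Nat.card_eq_fintype_card, Fintype.card_fin] at h1
  exact_mod_cast Nat.le_of_succ_le_succ h1

/-- The rank function of a maximal ranked poset determines its order. -/
theorem exists_rank_function [Finite P] {n : ℕ} (h : IsMaximalRanked P n) :
    ∃ r : P → ℕ, (∀ p q, p < q ↔ r p < r q) ∧ (∀ p k, k < r p → ∃ q, r q = k) ∧
      (∀ p, r p ≤ n) ∧ ∀ i, rankLevel P i = {p | r p = i} := by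
  have hle := height_le_of_isGradedOfRank h.1
  have hfin : ∀ p : P, Order.height p < ⊤ := fun p => (hle p).trans_lt (ENat.natCast_lt_top n)
  have hcoe : ∀ p : P, ((Order.height p).toNat : ℕ∞) = Order.height p := fun p =>
    ENat.natCast_toNat (hfin p).ne
  have hmono : ∀ p q : P, p < q → (Order.height p).toNat < (Order.height q).toNat := by
    intro p q hpq
    have := Order.height_strictMono hpq (hfin p)
    rw [← hcoe p, ← hcoe q] at this
    exact_mod_cast this
  refine ⟨fun p => (Order.height p).toNat, fun p q => ⟨hmono p q, fun hpq => ?_⟩,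
    fun p k hk => ?_, fun p => ?_, fun i => ?_⟩
  · rcases h.2 _ _ hpq.ne p (hcoe p).symm q (hcoe q).symm with h' | h'
    · refine lt_of_le_of_ne h' ?_
      rintro rfl
      exact lt_irrefl _ hpq
    · rcases h'.eq_or_lt with rfl | h'
      · exact absurd hpq (lt_irrefl _)
      · exact absurd (hmono q p h') hpq.not_gt
  · have hk' : (k : ℕ∞) < Order.height p := by
      rw [← hcoe p]
      exact_mod_cast hk
    obtain ⟨q, -, hq⟩ := (Order.coe_lt_height_iff (hfin p)).1 hk'
    exact ⟨q, by simp [hq]⟩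
  · have := hle p
    rw [← hcoe p] at this
    exact_mod_cast this
  · ext p
    change Order.height p = i ↔ (Order.height p).toNat = i
    rw [← hcoe p]
    simp

end Heights

end TriangularFaces

theorem mainTheorem3 {P : Type*} [PartialOrder P] [Finite P] (n : ℕ)
    (hP : IsMaximalRanked P n) (hX : ContainsXPoset P) :
    (triangularTwoFaces (orderPolytope P)).Finite ∧
    (triangularTwoFaces (chainPolytope P)).Finite ∧
    (triangularTwoFaces (chainPolytope P)).ncard =
      (triangularTwoFaces (orderPolytope P)).ncard +
        ∑ s ∈ Finset.Icc 2 n, ∑ t ∈ Finset.Icc 2 s,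
          ∑ m ∈ Finset.Icc 2 (rankLevel P s).ncard,
            ∑ l ∈ Finset.Icc 2 (rankLevel P (s - t)).ncard,
              (rankLevel P s).ncard.choose m * (rankLevel P (s - t)).ncard.choose l := by
  classical
  have := Fintype.ofFinite P
  obtain ⟨r, hr, hs, hn, hlevel⟩ := exists_rank_function hP
  have hOext : (orderPolytope P).extremePoints ℝ =
      Set.range fun A : LevelSet r => indicatorVector (LevelSet.ideal A) := by
    rw [extremePoints_orderPolytope]
    ext x
    constructor
    · rintro ⟨s, hs, rfl⟩
      obtain ⟨A, hA⟩ := LevelSet.exists_ideal_eq hr hs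
      exact ⟨A, by rw [← hA]⟩
    · rintro ⟨A, rfl⟩
      exact ⟨_, LevelSet.isLowerSet_ideal hr A, rfl⟩
  have hCext : (chainPolytope P).extremePoints ℝ =
      Set.range fun A : LevelSet r => indicatorVector A.1 := by
    rw [extremePoints_chainPolytope hr]
    ext x
    constructor
    · rintro ⟨s, hs, rfl⟩
      exact ⟨⟨s, hs⟩, rfl⟩
    · rintro ⟨A, rfl⟩
      exact ⟨_, A.2, rfl⟩
  have hO := triangularTwoFaces_finite_and_ncard convex_orderPolytope isCompact_orderPolytope
    (indicatorVector_injective.comp LevelSet.ideal_injective) hOext LevelSet.OrderAdj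
    LevelSet.weight (fun x y h => LevelSet.weight_lt_of_levelAdj h)
    (fun x y h1 h2 h3 => LevelSet.order_exchange hs hr h1 h2 h3)
    (fun x y z h1 h2 h3 => LevelSet.order_face hr hs h1 h2 h3)
  have hC := triangularTwoFaces_finite_and_ncard convex_chainPolytope isCompact_chainPolytope
    (indicatorVector_injective.comp Subtype.val_injective) hCext LevelSet.ChainAdj
    LevelSet.weight (fun x y h => LevelSet.weight_lt_of_levelAdj h)
    (fun x y h1 h2 h3 => LevelSet.chain_exchange h1 h2 h3)
    (fun x y z h1 h2 h3 => LevelSet.chain_face hr h1 h2 h3)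
  refine ⟨hO.1, hC.1, ?_⟩
  rw [hO.2, hC.2, LevelSet.ncard_chain_triangles hs, LevelSet.sum_bigCount hn]
  congr 1
  refine Finset.sum_congr rfl fun s _ => Finset.sum_congr rfl fun t _ => ?_
  rw [hlevel, hlevel, LevelSet.bigCount_eq, LevelSet.bigCount_eq, Finset.sum_mul_sum]
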